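/- Let $\mathbb T^2=\mathbb R^2/\mathbb Z^2$ and let $\mathrm{Diff}(\mathbb T^2)$ be the set of real-analytic diffeomorphisms of $\mathbb T^2$ homotopic to the identity. For $r>0$ let $A^r=\{(x,y)\in\mathbb C^2: |\operatorname{Im}x|<r,\ |\operatorname{Im}y|<r\}$, and let $C^\omega_r(\mathbb T^2)$ be the Banach space of $\mathbb Z^2$-periodic real-valued functions on $\mathbb R^2$ that extend to bounded holomorphic functions on $A^r$, with norm $|f|_r=\sup_{A^r}|f|$. Let $\mathrm{Diff}_r(\mathbb T^2)$ be the set of $F\in\mathrm{Diff}(\mathbb T^2)$ having a lift $(x,y)\mapsto(x+f_1(x,y),y+f_2(x,y))$ with $f_1,f_2\in C^\omega_r(\mathbb T^2)$, with the topology given by the distance $|F-G|_r=\max_i|f_i-g_i|_r$ (minimized over the choice of lifts). Equip $\mathrm{Diff}(\mathbb T^2)=\bigcup_{r>0}\mathrm{Diff}_r(\mathbb T^2)$ with the inductive limit topology: $O$ is open if and only if $O\cap\mathrm{Diff}_r(\mathbb T^2)$ is open in $\mathrm{Diff}_r(\mathbb T^2)$ for every $r>0$. For $\alpha\in\mathbb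 R$ let $R_\alpha(x,y)=(x+\alpha,y)$, let $\mathcal A_\alpha\subset\mathrm{Diff}(\mathbb T^2)$ be the set of all $F=T^{-1}\circ R_\alpha\circ T$ with $T$ a real-analytic diffeomorphism of $\mathbb T^2$ preserving Lebesgue measure, and let $\overline{\mathcal A_\alpha}$ be its closure in $\mathrm{Diff}(\mathbb T^2)$. **Theorem B.** There is a dense $G_\delta$ set of real numbers $\alpha$ for each of which $\overline{\mathcal A_\alpha}$ contains a set $D$, dense in $\overline{\mathcal A_\alpha}$, such that every $G\in D$ is minimal (every orbit is dense in $\mathbb T^2$), preserves Lebesgue measure, and is not ergodic with respect to Lebesgue measure. -/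

import Mathlib

open MeasureTheory Set
open scoped ENNReal

/-- The two-torus `ℝ² / ℤ²`, with its product topology and its Lebesgue measure `volume`. -/
abbrev Torus : Type := UnitAddCircle × UnitAddCircle

/-- The covering projection `ℝ² → ℝ² / ℤ²`. -/
def torusProj (p : ℝ × ℝ) : Torus := ((p.1 : UnitAddCircle), (p.2 : UnitAddCircle))

/-- A self-map of the torus is real-analytic if it has a real-analytic lift `ℝ² → ℝ²`
(no condition on the homotopy class). -/
def IsAnalyticTorusMap (F : Torus → Torus) : Prop :=
  ∃ L : ℝ × ℝ → ℝ × ℝ, AnalyticOnNhd ℝ L univ ∧ ∀ p, torusProj (L p) = F (torusProj p)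

/-- Analytic diffeomorphisms of the torus: the map and its inverse are real-analytic. -/
def IsAnalyticDiffeo (F : Torus ≃ₜ Torus) : Prop :=
  IsAnalyticTorusMap F ∧ IsAnalyticTorusMap F.symm

/-- `Diff(𝕋²)`: the analytic diffeomorphisms of the torus that are homotopic to the identity. -/
def DiffTorus : Type :=
  {F : Torus ≃ₜ Torus //
    IsAnalyticDiffeo F ∧ ContinuousMap.Homotopic (F : C(Torus, Torus)) (ContinuousMap.id Torus)}

/-- The complex neighbourhood `A^r = {|Im x| < r, |Im y| < r}` of the real plane. -/
def strip (r : ℝ) : Set (ℂ × ℂ) := {z | |z.1.im| < r ∧ |z.2.im| < r}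

/-- The supremum of `|φ|` over `A^r`, as an extended non-negative number. -/
noncomputable def stripNorm (r : ℝ) (φ : ℂ × ℂ → ℂ) : ℝ≥0∞ := ⨆ z ∈ strip r, ‖φ z‖ₑ

/-- `φ`, restricted to `A^r`, is the holomorphic extension of a function of the Banach space
`C_r^ω(𝕋²)`: it is holomorphic and bounded on `A^r`, `ℤ²`-periodic, and real on `ℝ²`.
The values of `φ` outside `A^r` play no role. -/
structure MemCOmega (r : ℝ) (φ : ℂ × ℂ → ℂ) : Prop where
  holomorphic : DifferentiableOn ℂ φ (strip r)
  bounded : stripNorm r φ < ⊤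
  periodic_fst : ∀ z ∈ strip r, φ (z.1 + 1, z.2) = φ z
  periodic_snd : ∀ z ∈ strip r, φ (z.1, z.2 + 1) = φ z
  real : ∀ x y : ℝ, (φ ((x : ℂ), (y : ℂ))).im = 0

/-- The pair `φ = (φ₁, φ₂)` belongs to `C_r^ω(𝕋²)²` and `(x, y) ↦ (x + φ₁(x, y), y + φ₂(x, y))`
is a lift of `F`. -/
structure IsStripLift (r : ℝ) (φ : (ℂ × ℂ → ℂ) × (ℂ × ℂ → ℂ)) (F : DiffTorus) : Prop where
  mem_fst : MemCOmega r φ.1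
  mem_snd : MemCOmega r φ.2
  lift : ∀ x y : ℝ,
    F.1 (torusProj (x, y)) = torusProj (x + (φ.1 ((x : ℂ), (y : ℂ))).re,
      y + (φ.2 ((x : ℂ), (y : ℂ))).re)

/-- `Diff_r(𝕋²)`: the diffeomorphisms with a lift `id + (f₁, f₂)`, `f₁, f₂ ∈ C_r^ω(𝕋²)`. -/
def DiffStrip (r : ℝ) : Set DiffTorus := {F | ∃ φ, IsStripLift r φ F}

/-- The distance `|F - G|_r = max (|f₁ - g₁|_r) (|f₂ - g₂|_r)` on `Diff_r(𝕋²)`. Lifts are only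
determined up to integer translations, so the smallest value over all lifts is taken. -/
noncomputable def diffEDist (r : ℝ) (F G : DiffTorus) : ℝ≥0∞ :=
  ⨅ (φ : (ℂ × ℂ → ℂ) × (ℂ × ℂ → ℂ)) (ψ : (ℂ × ℂ → ℂ) × (ℂ × ℂ → ℂ))
    (_ : IsStripLift r φ F) (_ : IsStripLift r ψ G),
    max (stripNorm r (φ.1 - ψ.1)) (stripNorm r (φ.2 - ψ.2))

/-- The inductive limit topology on `Diff(𝕋²)`: a set `O` is open if and only if for every `r > 0`
the set `O ∩ Diff_r(𝕋²)` is open in `Diff_r(𝕋²)` for the distance `|F - G|_r`. -/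
instance DiffTorus.instTopologicalSpace : TopologicalSpace DiffTorus where
  IsOpen O := ∀ r : ℝ, 0 < r → ∀ F ∈ O ∩ DiffStrip r, ∃ ε : ℝ≥0∞, 0 < ε ∧
    ∀ G ∈ DiffStrip r, diffEDist r F G < ε → G ∈ O
  isOpen_univ := fun _ _ _ _ => ⟨1, one_pos, fun _ _ _ => mem_univ _⟩
  isOpen_inter := by
    intro s t hs ht r hr F hF
    obtain ⟨ε, hε, h⟩ := hs r hr F ⟨hF.1.1, hF.2⟩
    obtain ⟨δ, hδ, k⟩ := ht r hr F ⟨hF.1.2, hF.2⟩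
    exact ⟨min ε δ, lt_min hε hδ, fun G hG hd =>
      ⟨h G hG (hd.trans_le (min_le_left _ _)), k G hG (hd.trans_le (min_le_right _ _))⟩⟩
  isOpen_sUnion := by
    intro S hS r hr F hF
    obtain ⟨s, hs, hFs⟩ := hF.1
    obtain ⟨ε, hε, h⟩ := hS s hs r hr F ⟨hFs, hF.2⟩
    exact ⟨ε, hε, fun G hG hd => ⟨s, hs, h G hG hd⟩⟩

/-- The rotation `R_α : (x, y) ↦ (x + α, y)` of the torus. -/
def torusRotation (α : ℝ) : Torus ≃ₜ Torus :=
  (Homeomorph.addRight (α : UnitAddCircle)).prodCongr (Homeomorph.refl UnitAddCircle)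

/-- `𝒜_α`: the `F ∈ Diff(𝕋²)` of the form `F = T⁻¹ ∘ R_α ∘ T` with an analytic area-preserving
diffeomorphism `T` of the torus. -/
def conjRotation (α : ℝ) : Set DiffTorus :=
  {F | ∃ T : Torus ≃ₜ Torus, IsAnalyticDiffeo T ∧
    MeasurePreserving T (volume : Measure Torus) (volume : Measure Torus) ∧
    ∀ p, F.1 p = T.symm (torusRotation α (T p))}

/-- A self-map of a topological space is minimal if every (forward) orbit is dense. For
homeomorphisms of a compact space this is the same as density of all two-sided orbits. -/
def IsMinimalMap {X : Type*} [TopologicalSpace X] (f : X → X) : Prop :=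
  ∀ x, Dense (range fun n : ℕ => f^[n] x)

/-! All maps in play are conjugates T⁻¹ ∘ S ∘ T of skew products S(x, y) = (x + α, y + φ(x)). If φ
is a coboundary v(x + α) - v(x) with v entire and periodic, the shear (x, y) ↦ (x, y + v(x))
conjugates R_α to S, so the conjugate lies in `conjRotation α` (`conjSkew_coboundary_mem`). The
examples use instead an infinite sum φ of such coboundaries whose transfer function is only
measurable.

The building blocks are peaks g(x) = b(qx), where b = `bump n` runs over [0, 1] but has small
integral. For n and q large the graph of u + g is nearly dense in the torus, since g sweeps a full
fibre over every interval of length 1/q while u hardly moves. If qα is extraordinarily close to an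
integer, the coboundary of g is nevertheless tiny on a complex strip. Irrational angles admitting
such q for every n form a dense Gδ set, by Baire. This gives `exists_correction`.

Corrections are added inductively (`exists_limitCocycle`), each negligible over the finite time in
which the previous stage made all orbits dense at its scale; hence the limit is minimal
(`LimitCocycle.isMinimalMap`). The integrals of the g's are summable, so their sum U is finite
almost everywhere and φ = U ∘ R_α - U there. Then y - U(x) mod 1 is an invariant function with
uniform distribution, which excludes ergodicity (`not_ergodic_of_hasSum`).

It remains to transport smallness of φ through T into the inductive limit topology. The lift of an
analytic T is quasi-periodic, so it extends holomorphically, with a Lipschitz bound, to a strip of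
uniform width. Therefore φ ↦ T⁻¹ ∘ S ∘ T is continuous for the supremum norm on a fixed strip
(`exists_forall_conjSkew_mem`). Small φ approximate T⁻¹ ∘ R_α ∘ T, and the partial sums put the
limit map in the closure. -/

/-! ### Complexification of real-analytic germs in two variables -/

/-- The inclusion `ℝ² → ℂ²`. -/
def complexPoint (p : ℝ × ℝ) : ℂ × ℂ := ((p.1 : ℂ), (p.2 : ℂ))

/-- The coordinate vectors of `ℝ²`, indexed by `Bool`. -/
def coordVec (b : Bool) : ℝ × ℝ := if b then (1, 0) else (0, 1)

/-- The coordinate functionals of `ℂ²`, indexed by `Bool`. -/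
noncomputable def coordFun (b : Bool) : ℂ × ℂ →L[ℂ] ℂ :=
  if b then ContinuousLinearMap.fst ℂ ℂ ℂ else ContinuousLinearMap.snd ℂ ℂ ℂ

lemma norm_coordVec (b : Bool) : ‖coordVec b‖ = 1 := by
  cases b <;> simp [coordVec, Prod.norm_def]

lemma norm_coordFun_le (b : Bool) : ‖coordFun b‖ ≤ 1 := by
  cases b
  · simp [coordFun]
  · simp [coordFun]

/-- The complexification of a power series in two real variables. -/
noncomputable def complexifySeries (p : FormalMultilinearSeries ℝ (ℝ × ℝ) ℝ) :
    FormalMultilinearSeries ℂ (ℂ × ℂ) ℂ := fun n =>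
  ∑ s : Fin n → Bool, ((p n (fun i => coordVec (s i)) : ℝ) : ℂ) •
    (ContinuousMultilinearMap.mkPiAlgebra ℂ (Fin n) ℂ).compContinuousLinearMap
      (fun i => coordFun (s i))

/-- There are 2 ^ n words in the coordinate vectors, each contributing at most ‖p n‖. The radius of
convergence thus shrinks by a factor of at most two. -/
lemma norm_complexifySeries_le (p : FormalMultilinearSeries ℝ (ℝ × ℝ) ℝ) (n : ℕ) :
    ‖complexifySeries p n‖ ≤ 2 ^ n * ‖p n‖ := by
  have key : ∀ s : Fin n → Bool, ‖((p n (fun i => coordVec (s i)) : ℝ) : ℂ) •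
      (ContinuousMultilinearMap.mkPiAlgebra ℂ (Fin n) ℂ).compContinuousLinearMap
      (fun i => coordFun (s i))‖ ≤ ‖p n‖ := by
    intro s
    rw [norm_smul, Complex.norm_real]
    have h1 : ‖p n (fun i => coordVec (s i))‖ ≤ ‖p n‖ := by
      simpa [norm_coordVec] using (p n).le_opNorm (fun i => coordVec (s i))
    have h2 : ‖(ContinuousMultilinearMap.mkPiAlgebra ℂ (Fin n) ℂ).compContinuousLinearMap
        (fun i => coordFun (s i))‖ ≤ 1 := by
      refine (ContinuousMultilinearMap.norm_compContinuousLinearMap_le _ _).trans ?_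
      rw [ContinuousMultilinearMap.norm_mkPiAlgebra, one_mul]
      exact Finset.prod_le_one (fun _ _ => norm_nonneg _) (fun i _ => norm_coordFun_le _)
    simpa using mul_le_mul h1 h2 (norm_nonneg _) (norm_nonneg _)
  refine (norm_sum_le _ _).trans ((Finset.sum_le_sum fun s _ => key s).trans ?_)
  simp

lemma complexifySeries_apply_real (p : FormalMultilinearSeries ℝ (ℝ × ℝ) ℝ) (n : ℕ) (v : ℝ × ℝ) :
    complexifySeries p n (fun _ => complexPoint v) = ((p n (fun _ => v) : ℝ) : ℂ) := by
  let c : Bool → ℝ := fun b => if b then v.1 else v.2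
  have hv : v = ∑ b : Bool, c b • coordVec b := by
    ext <;> simp [c, coordVec]
  have hc : ∀ b, coordFun b (complexPoint v) = (c b : ℂ) := by
    intro b; cases b <;> simp [coordFun, complexPoint, c]
  have h : p n (fun _ => v) = ∑ s : Fin n → Bool, (∏ i, c (s i)) * p n (fun i => coordVec (s i)) := by
    conv_lhs => rw [hv]
    rw [ContinuousMultilinearMap.map_sum]
    refine Finset.sum_congr rfl fun s _ => ?_
    rw [ContinuousMultilinearMap.map_smul_univ, smul_eq_mul]
  rw [h]
  simp only [complexifySeries, sum_apply,
    smul_apply, ContinuousMultilinearMap.compContinuousLinearMap_apply,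
    ContinuousMultilinearMap.mkPiAlgebra_apply, hc, smul_eq_mul]
  push_cast
  exact Finset.sum_congr rfl fun s _ => mul_comm _ _

lemma norm_complexPoint (v : ℝ × ℝ) : ‖complexPoint v‖ = ‖v‖ := by
  simp [complexPoint, Prod.norm_def]

lemma complexPoint_sub (v w : ℝ × ℝ) :
    complexPoint (v - w) = complexPoint v - complexPoint w := by
  simp [complexPoint]

lemma continuous_complexPoint : Continuous complexPoint := by
  unfold complexPoint; fun_prop

lemma dist_complexPoint (v w : ℝ × ℝ) : dist (complexPoint v) (complexPoint w) = dist v w := by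
  rw [dist_eq_norm, dist_eq_norm, ← complexPoint_sub, norm_complexPoint]

/-- A real-analytic germ in two variables is the restriction of a holomorphic one. -/
lemma AnalyticAt.exists_complexification {f : ℝ × ℝ → ℝ} {p : ℝ × ℝ} (hf : AnalyticAt ℝ f p) :
    ∃ ρ > 0, ∃ g : ℂ × ℂ → ℂ, AnalyticOnNhd ℂ g (Metric.ball (complexPoint p) ρ) ∧
      ∀ q ∈ Metric.ball p ρ, g (complexPoint q) = f q := by
  obtain ⟨P, R, hP⟩ := hf
  obtain ⟨r, hr0, hrP⟩ := ENNReal.lt_iff_exists_nnreal_btwn.1 (hP.r_pos.trans_le hP.r_le)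
  obtain ⟨C, -, hC⟩ := P.norm_mul_pow_le_of_lt_radius hrP
  have hr0' : 0 < r := by exact_mod_cast hr0
  have hrad : ((r / 2 : NNReal) : ℝ≥0∞) ≤ (complexifySeries P).radius := by
    refine FormalMultilinearSeries.le_radius_of_bound _ C fun n => ?_
    refine le_trans ?_ (hC n)
    calc _ ≤ (2 ^ n * ‖P n‖) * ((r / 2 : NNReal) : ℝ) ^ n := by
          gcongr; exact norm_complexifySeries_le P n
      _ = ‖P n‖ * (r : ℝ) ^ n := by
          push_cast; rw [div_pow]; field_simp
  have hpos : 0 < (complexifySeries P).radius :=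
    lt_of_lt_of_le (by exact_mod_cast (half_pos hr0' : 0 < r / 2)) hrad
  have hq := (complexifySeries P).hasFPowerSeriesOnBall hpos
  obtain ⟨ρ, hρ0, hρ⟩ := ENNReal.lt_iff_exists_nnreal_btwn.1 (lt_min hpos hP.r_pos)
  have hρ0' : 0 < (ρ : ℝ) := by exact_mod_cast hρ0
  refine ⟨ρ, hρ0', fun z => (complexifySeries P).sum (z - complexPoint p), ?_, ?_⟩
  · intro z hz
    have h1 : AnalyticAt ℂ (complexifySeries P).sum (z - complexPoint p) := by
      refine hq.analyticAt_of_mem ?_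
      rw [Metric.mem_ball, dist_eq_norm] at hz
      refine Metric.eball_subset_eball (hρ.le.trans (min_le_left _ _)) ?_
      rw [Metric.eball_coe]
      simpa using hz
    exact h1.comp_of_eq (by fun_prop) rfl
  · intro q hqm
    have hqn : ‖q - p‖ < ρ := by rwa [Metric.mem_ball, dist_eq_norm] at hqm
    have h2 : f q = P.sum (q - p) := by
      have := hP.sum (y := q - p) (by
        refine Metric.eball_subset_eball (hρ.le.trans (min_le_right _ _)) ?_
        rw [Metric.eball_coe]; simpa using hqn)
      simpa using this
    simp only [h2, ← complexPoint_sub, FormalMultilinearSeries.sum, complexifySeries_apply_real]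
    rw [Complex.ofReal_tsum]

/-! ### Complex strips and the identity principle from real points -/

/-- The horizontal strip `{|Im z| < r}`. -/
def lineStrip (r : ℝ) : Set ℂ := {z | |z.im| < r}

lemma isOpen_lineStrip (r : ℝ) : IsOpen (lineStrip r) :=
  isOpen_lt (by fun_prop) continuous_const

lemma convex_lineStrip (r : ℝ) : Convex ℝ (lineStrip r) := by
  have : lineStrip r = Complex.imLm ⁻¹' (Ioo (-r) r) := by
    ext z; simp [lineStrip, abs_lt]
  rw [this]
  exact (convex_Ioo _ _).linear_preimage _

lemma isOpen_strip (r : ℝ) : IsOpen (strip r) :=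
  (isOpen_lineStrip r).prod (isOpen_lineStrip r)

lemma convex_strip (r : ℝ) : Convex ℝ (strip r) :=
  (convex_lineStrip r).prod (convex_lineStrip r)

lemma strip_mono {r s : ℝ} (h : r ≤ s) : strip r ⊆ strip s := fun _ hz =>
  ⟨hz.1.trans_le h, hz.2.trans_le h⟩

lemma ofReal_mem_lineStrip {r : ℝ} (hr : 0 < r) (x : ℝ) : (x : ℂ) ∈ lineStrip r := by
  simpa [lineStrip] using hr

lemma complexPoint_mem_strip {r : ℝ} (hr : 0 < r) (p : ℝ × ℝ) : complexPoint p ∈ strip r :=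
  ⟨ofReal_mem_lineStrip hr _, ofReal_mem_lineStrip hr _⟩

/-- A holomorphic function of one variable vanishing at the real points of a connected open set
that meets the real line vanishes on that set. -/
lemma DifferentiableOn.eq_zero_of_real {U : Set ℂ} (hU : IsOpen U) (hUc : IsPreconnected U)
    {x₀ : ℝ} (hx₀ : (x₀ : ℂ) ∈ U) {f : ℂ → ℂ} (hf : DifferentiableOn ℂ f U)
    (h : ∀ x : ℝ, (x : ℂ) ∈ U → f x = 0) {z : ℂ} (hz : z ∈ U) : f z = 0 := by
  refine (hf.analyticOnNhd hU).eqOn_zero_of_preconnected_of_frequently_eq_zero hUc hx₀ ?_ hz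
  have ht : Filter.Tendsto (fun x : ℝ => (x : ℂ)) (nhdsWithin x₀ {x₀}ᶜ)
      (nhdsWithin (x₀ : ℂ) {(x₀ : ℂ)}ᶜ) := by
    refine tendsto_nhdsWithin_of_tendsto_nhds_of_eventually_within _
      (Complex.continuous_ofReal.continuousAt.tendsto.mono_left nhdsWithin_le_nhds) ?_
    filter_upwards [self_mem_nhdsWithin] with x hx
    simpa using hx
  refine ht.frequently (Filter.Eventually.frequently ?_)
  have : ∀ᶠ x : ℝ in nhds x₀, (x : ℂ) ∈ U :=
    Complex.continuous_ofReal.continuousAt.eventually (hU.mem_nhds hx₀)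
  filter_upwards [nhdsWithin_le_nhds this] with x hx using h x hx

/-- The identity principle on products: a holomorphic function of two variables on `U ×ˢ V` that
vanishes at the real points vanishes identically. -/
lemma DifferentiableOn.eq_zero_of_real_prod {U V : Set ℂ} (hU : IsOpen U) (hUc : IsPreconnected U)
    (hV : IsOpen V) (hVc : IsPreconnected V) {x₀ y₀ : ℝ} (hx₀ : (x₀ : ℂ) ∈ U) (hy₀ : (y₀ : ℂ) ∈ V)
    {g : ℂ × ℂ → ℂ} (hg : DifferentiableOn ℂ g (U ×ˢ V))
    (h : ∀ x y : ℝ, (x : ℂ) ∈ U → (y : ℂ) ∈ V → g (x, y) = 0) {z : ℂ × ℂ} (hz : z ∈ U ×ˢ V) :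
    g z = 0 := by
  have h1 : ∀ y : ℝ, (y : ℂ) ∈ V → ∀ w ∈ U, g (w, y) = 0 := fun y hy w hw =>
    DifferentiableOn.eq_zero_of_real (f := fun w => g (w, y)) hU hUc hx₀
      (hg.comp (f := fun w : ℂ => (w, (y : ℂ))) (by fun_prop) fun w hw => ⟨hw, hy⟩)
      (fun x hx => h x y hx hy) hw
  exact DifferentiableOn.eq_zero_of_real (f := fun w => g (z.1, w)) hV hVc hy₀
      (hg.comp (f := fun w : ℂ => (z.1, w)) (by fun_prop) fun w hw => ⟨hz.1, hw⟩)
      (fun y hy => h1 y hy z.1 hz.1) hz.2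

lemma eq_zero_on_strip {r : ℝ} (hr : 0 < r) {g : ℂ × ℂ → ℂ} (hg : DifferentiableOn ℂ g (strip r))
    (h : ∀ x y : ℝ, g (x, y) = 0) {z : ℂ × ℂ} (hz : z ∈ strip r) : g z = 0 :=
  DifferentiableOn.eq_zero_of_real_prod (isOpen_lineStrip r) (convex_lineStrip r).isPreconnected
    (isOpen_lineStrip r) (convex_lineStrip r).isPreconnected (ofReal_mem_lineStrip hr 0)
    (ofReal_mem_lineStrip hr 0) hg (fun x y _ _ => h x y) hz

lemma add_one_mem_lineStrip {r : ℝ} {z : ℂ} (hz : z ∈ lineStrip r) : z + 1 ∈ lineStrip r := by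
  simpa [lineStrip] using hz

/-- Quasi-periodicity passes from real points to the strip. -/
lemma quasiPeriodic_fst_on_strip {r : ℝ} (hr : 0 < r) {Φ : ℂ × ℂ → ℂ}
    (hΦ : DifferentiableOn ℂ Φ (strip r)) {a : ℂ}
    (h : ∀ x y : ℝ, Φ (x + 1, y) = Φ (x, y) + a) {z : ℂ × ℂ} (hz : z ∈ strip r) :
    Φ (z.1 + 1, z.2) = Φ z + a := by
  have hd : DifferentiableOn ℂ (fun z : ℂ × ℂ => Φ (z.1 + 1, z.2) - (Φ z + a)) (strip r) :=
    (hΦ.comp (f := fun z : ℂ × ℂ => (z.1 + 1, z.2)) (by fun_prop)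
      fun z hz => ⟨add_one_mem_lineStrip hz.1, hz.2⟩).sub (hΦ.add_const _)
  exact sub_eq_zero.1 (eq_zero_on_strip hr hd (fun x y => by simp [h]) hz)

lemma quasiPeriodic_snd_on_strip {r : ℝ} (hr : 0 < r) {Φ : ℂ × ℂ → ℂ}
    (hΦ : DifferentiableOn ℂ Φ (strip r)) {a : ℂ}
    (h : ∀ x y : ℝ, Φ (x, y + 1) = Φ (x, y) + a) {z : ℂ × ℂ} (hz : z ∈ strip r) :
    Φ (z.1, z.2 + 1) = Φ z + a := by
  have hd : DifferentiableOn ℂ (fun z : ℂ × ℂ => Φ (z.1, z.2 + 1) - (Φ z + a)) (strip r) :=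
    (hΦ.comp (f := fun z : ℂ × ℂ => (z.1, z.2 + 1)) (by fun_prop)
      fun z hz => ⟨hz.1, add_one_mem_lineStrip hz.2⟩).sub (hΦ.add_const _)
  exact sub_eq_zero.1 (eq_zero_on_strip hr hd (fun x y => by simp [h]) hz)

/-! ### Quasi-periodic analytic functions and their extension to strips -/

/-- A function of two real variables that is additively quasi-periodic under `ℤ²`. -/
structure QuasiPeriodic (f : ℝ × ℝ → ℝ) (a b : ℝ) : Prop where
  fst : ∀ x y, f (x + 1, y) = f (x, y) + a
  snd : ∀ x y, f (x, y + 1) = f (x, y) + b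

lemma QuasiPeriodic.add_int {f : ℝ × ℝ → ℝ} {a b : ℝ} (h : QuasiPeriodic f a b) (x y : ℝ)
    (m n : ℤ) : f (x + m, y + n) = f (x, y) + (m * a + n * b) := by
  have h1 : Function.Periodic (fun x => f (x, y + n) - x * a) 1 := fun x => by
    simp only [h.fst]; ring
  have h2 : Function.Periodic (fun y => f (x, y) - y * b) 1 := fun y => by
    simp only [h.snd]; ring
  have e1 := h1.int_mul m x
  have e2 := h2.int_mul n y
  simp only [mul_one] at e1 e2
  linarith

/-- A Lebesgue number for the unit square makes the radius uniform there; integer translations carry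
it to the whole plane, since they change f only by an additive constant. -/
lemma QuasiPeriodic.exists_uniform_complexification {f : ℝ × ℝ → ℝ} {a b : ℝ}
    (h : QuasiPeriodic f a b) (hf : AnalyticOnNhd ℝ f univ) :
    ∃ ρ > 0, ∀ p : ℝ × ℝ, ∃ g : ℂ × ℂ → ℂ, AnalyticOnNhd ℂ g (Metric.ball (complexPoint p) ρ) ∧
      ∀ q ∈ Metric.ball p ρ, g (complexPoint q) = f q := by
  choose R hR0 g hg hgf using fun p => (hf p (mem_univ p)).exists_complexification
  have hK : IsCompact (complexPoint '' (Icc 0 1 ×ˢ Icc 0 1)) :=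
    (isCompact_Icc.prod isCompact_Icc).image continuous_complexPoint
  obtain ⟨ρ, hρ0, hρ⟩ := lebesgue_number_lemma_of_metric (ι := ℝ × ℝ) hK
    (c := fun p => Metric.ball (complexPoint p) (R p)) (fun _ => Metric.isOpen_ball) (by
      rintro _ ⟨p, -, rfl⟩
      exact mem_iUnion.2 ⟨p, Metric.mem_ball_self (hR0 p)⟩)
  refine ⟨ρ, hρ0, fun p => ?_⟩
  let m := ⌊p.1⌋
  let n := ⌊p.2⌋
  let k : ℝ × ℝ := ((m : ℝ), (n : ℝ))
  obtain ⟨p₀, hp₀⟩ := hρ (complexPoint (p - k)) ⟨p - k, by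
    refine ⟨⟨?_, ?_⟩, ⟨?_, ?_⟩⟩ <;> simp only [k, m, n, Prod.fst_sub, Prod.snd_sub]
    · linarith [Int.floor_le p.1]
    · linarith [Int.lt_floor_add_one p.1]
    · linarith [Int.floor_le p.2]
    · linarith [Int.lt_floor_add_one p.2], rfl⟩
  have hmem : ∀ z ∈ Metric.ball (complexPoint p) ρ,
      z - complexPoint k ∈ Metric.ball (complexPoint p₀) (R p₀) := by
    intro z hz
    apply hp₀
    rw [Metric.mem_ball, complexPoint_sub, dist_sub_right]
    exact hz
  refine ⟨fun z => g p₀ (z - complexPoint k) + ((m * a + n * b : ℝ) : ℂ), ?_, ?_⟩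
  · intro z hz
    exact (AnalyticAt.comp_of_eq (f := fun z => z - complexPoint k) (hg p₀ _ (hmem z hz))
      (by fun_prop) rfl).add analyticAt_const
  · intro q hq
    have hq' : q - k ∈ Metric.ball p₀ (R p₀) := by
      have := hmem (complexPoint q) (by rwa [Metric.mem_ball, dist_complexPoint])
      rwa [← complexPoint_sub, Metric.mem_ball, dist_complexPoint] at this
    have e := h.add_int (q - k).1 (q - k).2 m n
    have e' : ((q - k).1 + (m : ℝ), (q - k).2 + (n : ℝ)) = q := by simp [k]
    rw [e'] at e
    simp only [← complexPoint_sub, hgf p₀ _ hq', e]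
    push_cast; ring

lemma mem_ball_complexPoint {z : ℂ × ℂ} {p : ℝ × ℝ} {ρ : ℝ} :
    z ∈ Metric.ball (complexPoint p) ρ ↔
      z ∈ Metric.ball (p.1 : ℂ) ρ ×ˢ Metric.ball (p.2 : ℂ) ρ := by
  rw [ball_prod_same]; rfl

/-- The real part of a point of `ℂ²`. -/
def rePoint (z : ℂ × ℂ) : ℝ × ℝ := (z.1.re, z.2.re)

lemma mem_ball_rePoint {z : ℂ × ℂ} {ρ : ℝ} :
    z ∈ Metric.ball (complexPoint (rePoint z)) ρ ↔ z ∈ strip ρ := by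
  have h : ∀ w : ℂ, dist w (w.re : ℂ) = |w.im| := fun w => by
    rw [Complex.dist_of_re_eq (by simp)]; simp
  rw [mem_ball_complexPoint]
  simp [rePoint, strip, h]

lemma rePoint_mem_ball {z : ℂ × ℂ} {p : ℝ × ℝ} {ρ : ℝ}
    (hz : z ∈ Metric.ball (complexPoint p) ρ) : rePoint z ∈ Metric.ball p ρ := by
  have h : ∀ (w : ℂ) (x : ℝ), dist w.re x ≤ dist w x := fun w x => by
    rw [Real.dist_eq, dist_eq_norm]; simpa using Complex.abs_re_le_norm (w - x)
  rw [mem_ball_complexPoint] at hz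
  rw [← Prod.mk.eta (p := p), ← ball_prod_same]
  exact ⟨(h _ _).trans_lt hz.1, (h _ _).trans_lt hz.2⟩

lemma mem_strip_of_mem_ball {z : ℂ × ℂ} {p : ℝ × ℝ} {ρ : ℝ}
    (hz : z ∈ Metric.ball (complexPoint p) ρ) : z ∈ strip ρ := by
  have h : ∀ (w : ℂ) (x : ℝ), |w.im| ≤ dist w x := fun w x => by
    rw [dist_eq_norm]; simpa using Complex.abs_im_le_norm (w - x)
  rw [mem_ball_complexPoint] at hz
  exact ⟨(h _ _).trans_lt hz.1, (h _ _).trans_lt hz.2⟩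

/-- A quasi-periodic real-analytic function extends holomorphically to a strip. -/
theorem QuasiPeriodic.exists_strip_extension {f : ℝ × ℝ → ℝ} {a b : ℝ}
    (h : QuasiPeriodic f a b) (hf : AnalyticOnNhd ℝ f univ) :
    ∃ ρ > 0, ∃ Φ : ℂ × ℂ → ℂ, AnalyticOnNhd ℂ Φ (strip ρ) ∧ ∀ p, Φ (complexPoint p) = f p := by
  obtain ⟨ρ, hρ0, hρ⟩ := h.exists_uniform_complexification hf
  choose g hg hgf using hρ
  -- The local extensions are glued by using at z the one centred at its real part. Two of them
  -- agree on the overlap of their balls, which is a product of convex sets meeting the real plane.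
  let Φ : ℂ × ℂ → ℂ := fun z => g (rePoint z) z
  have key : ∀ p, ∀ z ∈ Metric.ball (complexPoint p) ρ, Φ z = g p z := by
    intro p z hz
    set q := rePoint z with hq
    have hzq : z ∈ Metric.ball (complexPoint q) ρ :=
      mem_ball_rePoint.2 (mem_strip_of_mem_ball hz)
    have hqp : complexPoint q ∈ Metric.ball (complexPoint p) ρ := by
      rw [Metric.mem_ball, dist_complexPoint]; exact rePoint_mem_ball hz
    have hqq : complexPoint q ∈ Metric.ball (complexPoint q) ρ := Metric.mem_ball_self hρ0
    have hd : DifferentiableOn ℂ (fun w => g q w - g p w)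
        (Metric.ball (complexPoint q) ρ ∩ Metric.ball (complexPoint p) ρ) :=
      ((hg q).differentiableOn.mono inter_subset_left).sub
        ((hg p).differentiableOn.mono inter_subset_right)
    have hset : Metric.ball (complexPoint q) ρ ∩ Metric.ball (complexPoint p) ρ =
        (Metric.ball (q.1 : ℂ) ρ ∩ Metric.ball (p.1 : ℂ) ρ) ×ˢ
          (Metric.ball (q.2 : ℂ) ρ ∩ Metric.ball (p.2 : ℂ) ρ) := by
      rw [← prod_inter_prod, ball_prod_same, ball_prod_same]; rfl
    rw [hset] at hd
    have hc : ∀ x y : ℝ, IsPreconnected (Metric.ball (x : ℂ) ρ ∩ Metric.ball (y : ℂ) ρ) :=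
      fun x y => ((convex_ball _ _).inter (convex_ball _ _)).isPreconnected
    have hqm : complexPoint q ∈ (Metric.ball (q.1 : ℂ) ρ ∩ Metric.ball (p.1 : ℂ) ρ) ×ˢ
          (Metric.ball (q.2 : ℂ) ρ ∩ Metric.ball (p.2 : ℂ) ρ) := hset ▸ ⟨hqq, hqp⟩
    have hzm : z ∈ (Metric.ball (q.1 : ℂ) ρ ∩ Metric.ball (p.1 : ℂ) ρ) ×ˢ
          (Metric.ball (q.2 : ℂ) ρ ∩ Metric.ball (p.2 : ℂ) ρ) := hset ▸ ⟨hzq, hz⟩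
    refine sub_eq_zero.1 (DifferentiableOn.eq_zero_of_real_prod
      (Metric.isOpen_ball.inter Metric.isOpen_ball) (hc _ _)
      (Metric.isOpen_ball.inter Metric.isOpen_ball) (hc _ _) hqm.1 hqm.2 hd ?_ hzm)
    intro x y hx hy
    have hm : complexPoint (x, y) ∈
        Metric.ball (complexPoint q) ρ ∩ Metric.ball (complexPoint p) ρ := hset ▸ ⟨hx, hy⟩
    have e1 := hgf q (x, y) (by
      have := hm.1; rwa [Metric.mem_ball, dist_complexPoint] at this)
    have e2 := hgf p (x, y) (by
      have := hm.2; rwa [Metric.mem_ball, dist_complexPoint] at this)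
    exact sub_eq_zero.2 (e1.trans e2.symm)
  refine ⟨ρ, hρ0, Φ, ?_, ?_⟩
  · intro z hz
    have hz' := mem_ball_rePoint.2 hz
    refine (hg _ z hz').congr ?_
    filter_upwards [Metric.isOpen_ball.mem_nhds hz'] with w hw using (key _ w hw).symm
  · intro p
    exact hgf p p (Metric.mem_ball_self hρ0)

/-- A continuous periodic function on a strip is bounded on smaller strips. -/
lemma exists_bound_of_periodic {E : Type*} [SeminormedAddCommGroup E] {ρ r : ℝ} (hr : r < ρ)
    {Ψ : ℂ × ℂ → E} (hc : ContinuousOn Ψ (strip ρ))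
    (h1 : ∀ z ∈ strip ρ, Ψ (z.1 + 1, z.2) = Ψ z) (h2 : ∀ z ∈ strip ρ, Ψ (z.1, z.2 + 1) = Ψ z) :
    ∃ M, ∀ z ∈ strip r, ‖Ψ z‖ ≤ M := by
  have hK : IsCompact ((Icc 0 1 ×ℂ Icc (-r) r) ×ˢ (Icc 0 1 ×ℂ Icc (-r) r)) :=
    (isCompact_Icc.reProdIm isCompact_Icc).prod (isCompact_Icc.reProdIm isCompact_Icc)
  have hKs : (Icc 0 1 ×ℂ Icc (-r) r) ×ˢ (Icc 0 1 ×ℂ Icc (-r) r) ⊆ strip ρ := fun z hz =>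
    ⟨(abs_le.2 hz.1.2).trans_lt hr, (abs_le.2 hz.2.2).trans_lt hr⟩
  obtain ⟨M, hM⟩ := hK.exists_bound_of_continuousOn (hc.mono hKs)
  refine ⟨M, fun z hz => ?_⟩
  have hzρ := strip_mono hr.le hz
  let c : ℝ → ℝ → ℂ × ℂ := fun s t => (s + z.1.im * Complex.I, t + z.2.im * Complex.I)
  have hcm : ∀ s t, c s t ∈ strip ρ := fun s t => by
    simpa [c, strip] using hzρ
  have p1 : ∀ t, Function.Periodic (fun s => Ψ (c s t)) 1 := fun t s => by
    refine Eq.trans ?_ (h1 _ (hcm s t))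
    simp [c, add_right_comm]
  have p2 : ∀ s, Function.Periodic (fun t => Ψ (c s t)) 1 := fun s t => by
    refine Eq.trans ?_ (h2 _ (hcm s t))
    simp [c, add_right_comm]
  have hz' : z = c z.1.re z.2.re := by simp [c]
  have e1 := (p1 z.2.re).sub_int_mul_eq (x := z.1.re) ⌊z.1.re⌋
  have e2 := (p2 (z.1.re - ⌊z.1.re⌋ * 1)).sub_int_mul_eq (x := z.2.re) ⌊z.2.re⌋
  have e3 : Ψ z = Ψ (c (z.1.re - ⌊z.1.re⌋ * 1) (z.2.re - ⌊z.2.re⌋ * 1)) := by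
    conv_lhs => rw [hz']
    exact (e2.trans e1).symm
  rw [e3]
  refine hM _ ⟨⟨?_, ?_⟩, ⟨?_, ?_⟩⟩
  · simpa [c] using (Int.fract_lt_one z.1.re).le
  · simpa [c] using abs_le.1 hz.1.le
  · simpa [c] using (Int.fract_lt_one z.2.re).le
  · simpa [c] using abs_le.1 hz.2.le

/-- A quasi-periodic analytic function on a strip is Lipschitz on smaller strips. -/
lemma exists_lipschitzOnWith_of_quasiPeriodic {ρ r : ℝ} (hr : r < ρ) {Φ : ℂ × ℂ → ℂ}
    (hΦ : AnalyticOnNhd ℂ Φ (strip ρ)) {a b : ℂ}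
    (h1 : ∀ z ∈ strip ρ, Φ (z.1 + 1, z.2) = Φ z + a)
    (h2 : ∀ z ∈ strip ρ, Φ (z.1, z.2 + 1) = Φ z + b) :
    ∃ K, LipschitzOnWith K Φ (strip r) := by
  -- The derivative of a quasi-periodic function is genuinely periodic, hence bounded on a smaller
  -- strip.
  have hper : ∀ (e : ℂ × ℂ) (c : ℂ), (∀ z ∈ strip ρ, Φ (z + e) = Φ z + c) → ∀ z ∈ strip ρ,
      fderiv ℂ Φ (z + e) = fderiv ℂ Φ z := by
    intro e c h z hz
    rw [← fderiv_comp_add_right]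
    have : (fun x => Φ (x + e)) =ᶠ[nhds z] fun x => Φ x + c := by
      filter_upwards [(isOpen_strip ρ).mem_nhds hz] with w hw using h w hw
    rw [this.fderiv_eq, fderiv_add_const]
  obtain ⟨M, hM⟩ := exists_bound_of_periodic hr (Ψ := fderiv ℂ Φ) hΦ.fderiv.continuousOn
    (fun z hz => by
      have := hper (1, 0) a (fun z hz => by rw [← h1 z hz]; congr 1; ext <;> simp) z hz
      rw [← this]; congr 1; ext <;> simp)
    (fun z hz => by
      have := hper (0, 1) b (fun z hz => by rw [← h2 z hz]; congr 1; ext <;> simp) z hz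
      rw [← this]; congr 1; ext <;> simp)
  refine ⟨M.toNNReal, (convex_strip r).lipschitzOnWith_of_nnnorm_fderiv_le (𝕜 := ℂ)
    (fun z hz => (hΦ z (strip_mono hr.le hz)).differentiableAt) fun z hz => ?_⟩
  rw [← NNReal.coe_le_coe, coe_nnnorm]
  exact (hM z hz).trans (Real.le_coe_toNNReal M)

/-- Holomorphic extension of quasi-periodic real-analytic functions, with a Lipschitz bound. -/
theorem QuasiPeriodic.exists_lipschitz_extension {f : ℝ × ℝ → ℝ} {a b : ℝ}
    (h : QuasiPeriodic f a b) (hf : AnalyticOnNhd ℝ f univ) :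
    ∃ ρ > 0, ∃ Φ : ℂ × ℂ → ℂ, DifferentiableOn ℂ Φ (strip ρ) ∧
      (∀ p, Φ (complexPoint p) = f p) ∧ ∃ K, LipschitzOnWith K Φ (strip ρ) := by
  obtain ⟨ρ, hρ0, Φ, hΦ, hΦf⟩ := h.exists_strip_extension hf
  refine ⟨ρ / 2, half_pos hρ0, Φ, hΦ.differentiableOn.mono (strip_mono (by linarith)), hΦf, ?_⟩
  refine exists_lipschitzOnWith_of_quasiPeriodic (half_lt_self hρ0) hΦ (a := a) (b := b) ?_ ?_
  · refine fun z hz => quasiPeriodic_fst_on_strip hρ0 hΦ.differentiableOn (fun x y => ?_) hz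
    have e1 := hΦf (x + 1, y)
    have e2 := hΦf (x, y)
    simp only [complexPoint, h.fst] at e1 e2
    push_cast at e1
    rw [e1, e2]
  · refine fun z hz => quasiPeriodic_snd_on_strip hρ0 hΦ.differentiableOn (fun x y => ?_) hz
    have e1 := hΦf (x, y + 1)
    have e2 := hΦf (x, y)
    simp only [complexPoint, h.snd] at e1 e2
    push_cast at e1
    rw [e1, e2]

/-! ### Periodic holomorphic functions of one variable -/

/-- `φ` is holomorphic on `{|Im z| < 1}`, and `1`-periodic and real on the real line. -/
structure CircleHolo (φ : ℂ → ℂ) : Prop where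
  holo : DifferentiableOn ℂ φ (lineStrip 1)
  periodic : ∀ x : ℝ, φ (x + 1) = φ x
  real : ∀ x : ℝ, (φ x).im = 0

namespace CircleHolo

variable {φ : ℂ → ℂ}

lemma ofReal_re (h : CircleHolo φ) (x : ℝ) : ((φ x).re : ℂ) = φ x :=
  Complex.ext (by simp) (by simp [h.real])

lemma periodic_re (h : CircleHolo φ) : Function.Periodic (fun x : ℝ => (φ x).re) 1 := fun x => by
  simp [h.periodic]

lemma analyticOnNhd_re (h : CircleHolo φ) : AnalyticOnNhd ℝ (fun x : ℝ => (φ x).re) univ :=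
  fun x _ => ((h.holo.analyticOnNhd (isOpen_lineStrip 1)) x
    (ofReal_mem_lineStrip one_pos x)).re_ofReal

lemma continuous_re (h : CircleHolo φ) : Continuous (fun x : ℝ => (φ x).re) :=
  continuousOn_univ.1 h.analyticOnNhd_re.continuousOn

/-- The function on the circle induced by `φ`. -/
noncomputable def circleMap (h : CircleHolo φ) : C(UnitAddCircle, ℝ) where
  toFun := h.periodic_re.lift
  continuous_toFun := continuous_coinduced_dom.2 h.continuous_re

@[simp] lemma circleMap_coe (h : CircleHolo φ) (x : ℝ) :
    h.circleMap (x : UnitAddCircle) = (φ x).re := rfl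

/-- If `φ` is bounded by `1`, its imaginary part is controlled by the distance to the real line. -/
lemma abs_im_le (h : CircleHolo φ) (hb : ∀ z ∈ lineStrip 1, ‖φ z‖ ≤ 1) {z : ℂ}
    (hz : z ∈ lineStrip (1 / 2)) : |(φ z).im| ≤ 2 * |z.im| := by
  have hball : ∀ w ∈ lineStrip (1 / 2), Metric.closedBall w (1 / 2) ⊆ lineStrip 1 := by
    intro w hw v hv
    have h1 : |v.im - w.im| ≤ 1 / 2 := by
      simpa using (Complex.abs_im_le_norm (v - w)).trans (mem_closedBall_iff_norm.1 hv)
    have h2 : |w.im| < 1 / 2 := hw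
    have h3 : |v.im| ≤ |v.im - w.im| + |w.im| := by
      simpa using abs_add_le (v.im - w.im) w.im
    show |v.im| < 1
    linarith
  -- Cauchy's estimate on discs of radius 1/2, which stay inside the unit strip.
  have hd : ∀ w ∈ lineStrip (1 / 2), ‖deriv φ w‖ ≤ 2 := by
    intro w hw
    have := Complex.norm_deriv_le_of_forall_mem_sphere_norm_le (f := φ) (c := w) (R := 1 / 2)
      (C := 1) (by norm_num)
      ((h.holo.mono (hball w hw)).diffContOnCl_ball subset_rfl)
      (fun v hv => hb v (hball w hw (Metric.sphere_subset_closedBall hv)))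
    norm_num at this ⊢
    exact this
  have hdiff : ∀ w ∈ lineStrip (1 / 2), DifferentiableAt ℂ φ w := fun w hw =>
    h.holo.differentiableAt ((isOpen_lineStrip 1).mem_nhds
      (hball w hw (Metric.mem_closedBall_self (by norm_num))))
  have hl := (convex_lineStrip (1 / 2)).norm_image_sub_le_of_norm_deriv_le hdiff hd
    (ofReal_mem_lineStrip (by norm_num) z.re) hz
  have e1 : |(φ z).im| ≤ ‖φ z - φ z.re‖ := by
    simpa [h.real] using Complex.abs_im_le_norm (φ z - φ z.re)
  have e2 : ‖z - z.re‖ = |z.im| := by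
    rw [← dist_eq_norm, Complex.dist_of_re_eq (by simp)]; simp
  rw [e2] at hl
  exact e1.trans hl

end CircleHolo

/-! ### Skew products and their conjugates -/

/-- The skew product `(x, y) ↦ (x + α, y + c(x))` of the torus. -/
def skewHomeo (α : ℝ) (c : C(UnitAddCircle, ℝ)) : Torus ≃ₜ Torus where
  toFun p := (p.1 + (α : UnitAddCircle), p.2 + (c p.1 : UnitAddCircle))
  invFun p := (p.1 - (α : UnitAddCircle), p.2 - (c (p.1 - (α : UnitAddCircle)) : UnitAddCircle))
  left_inv p := by simp
  right_inv p := by simp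
  continuous_toFun := by
    have := AddCircle.continuous_mk' (1 : ℝ)
    fun_prop
  continuous_invFun := by
    have := AddCircle.continuous_mk' (1 : ℝ)
    fun_prop

lemma skewHomeo_apply (α : ℝ) (c : C(UnitAddCircle, ℝ)) (p : Torus) :
    skewHomeo α c p = (p.1 + (α : UnitAddCircle), p.2 + (c p.1 : UnitAddCircle)) := rfl

lemma skewHomeo_homotopic (α : ℝ) (c : C(UnitAddCircle, ℝ)) :
    ContinuousMap.Homotopic (skewHomeo α c : C(Torus, Torus)) (ContinuousMap.id Torus) := by
  refine ContinuousMap.Homotopic.symm ⟨⟨⟨fun q => (q.2.1 + (((q.1 : ℝ) * α : ℝ) : UnitAddCircle),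
    q.2.2 + (((q.1 : ℝ) * c q.2.1 : ℝ) : UnitAddCircle)), ?_⟩, ?_, ?_⟩⟩
  · have := AddCircle.continuous_mk' (1 : ℝ)
    fun_prop
  · intro p
    simp
  · intro p
    simp [skewHomeo_apply]

/-- The real lift of a skew product. -/
def skewLift (α : ℝ) (f : ℝ → ℝ) (p : ℝ × ℝ) : ℝ × ℝ := (p.1 + α, p.2 + f p.1)

/-- The complexified lift of a skew product. -/
def skewComplex (α : ℝ) (φ : ℂ → ℂ) (z : ℂ × ℂ) : ℂ × ℂ := (z.1 + α, z.2 + φ z.1)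

lemma skewComplex_complexPoint {φ : ℂ → ℂ} (h : CircleHolo φ) (α : ℝ) (p : ℝ × ℝ) :
    skewComplex α φ (complexPoint p) = complexPoint (skewLift α (fun x => (φ x).re) p) := by
  simp [skewComplex, complexPoint, skewLift, h.ofReal_re]

lemma skewHomeo_torusProj {φ : ℂ → ℂ} (h : CircleHolo φ) (α : ℝ) (p : ℝ × ℝ) :
    skewHomeo α h.circleMap (torusProj p) = torusProj (skewLift α (fun x => (φ x).re) p) := by
  simp [skewHomeo_apply, torusProj, skewLift]

lemma AnalyticOnNhd.skewLift {f : ℝ → ℝ} (hf : AnalyticOnNhd ℝ f univ) (α : ℝ) :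
    AnalyticOnNhd ℝ (skewLift α f) univ := fun p _ =>
  (analyticAt_fst.add analyticAt_const).prod
    (analyticAt_snd.add ((hf p.1 (mem_univ _)).comp_of_eq analyticAt_fst rfl))

lemma torusProj_surjective : Function.Surjective torusProj := fun p => by
  obtain ⟨x, hx⟩ := QuotientAddGroup.mk_surjective p.1
  obtain ⟨y, hy⟩ := QuotientAddGroup.mk_surjective p.2
  exact ⟨(x, y), Prod.ext hx hy⟩

lemma IsAnalyticTorusMap.comp {F G : Torus → Torus} (hF : IsAnalyticTorusMap F)
    (hG : IsAnalyticTorusMap G) : IsAnalyticTorusMap (F ∘ G) := by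
  obtain ⟨L, hL, hLF⟩ := hF
  obtain ⟨L', hL', hLG⟩ := hG
  exact ⟨L ∘ L', hL.comp hL' (mapsTo_univ _ _), fun p => by simp [hLF, hLG]⟩

lemma IsAnalyticDiffeo.symm {F : Torus ≃ₜ Torus} (h : IsAnalyticDiffeo F) :
    IsAnalyticDiffeo F.symm := ⟨h.2, h.1⟩

lemma IsAnalyticDiffeo.trans {F G : Torus ≃ₜ Torus} (hF : IsAnalyticDiffeo F)
    (hG : IsAnalyticDiffeo G) : IsAnalyticDiffeo (F.trans G) :=
  ⟨hG.1.comp hF.1, hF.2.comp hG.2⟩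

lemma isAnalyticDiffeo_skewHomeo {φ : ℂ → ℂ} (h : CircleHolo φ) (α : ℝ) :
    IsAnalyticDiffeo (skewHomeo α h.circleMap) := by
  refine ⟨⟨_, h.analyticOnNhd_re.skewLift α, fun p => (skewHomeo_torusProj h α p).symm⟩,
    ⟨fun p => (p.1 - α, p.2 - (φ ((p.1 - α : ℝ) : ℂ)).re), ?_, fun p => ?_⟩⟩
  · intro p _
    refine (analyticAt_fst.sub analyticAt_const).prod (analyticAt_snd.sub ?_)
    exact (h.analyticOnNhd_re (p.1 - α) (mem_univ _)).comp_of_eq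
      (analyticAt_fst.sub analyticAt_const) rfl
  · rw [Homeomorph.eq_symm_apply, skewHomeo_torusProj]
    simp [skewLift]

/-- The conjugate `T⁻¹ ∘ G ∘ T` of the skew product `G(x, y) = (x + α, y + φ(x))`. -/
noncomputable def conjSkew {T : Torus ≃ₜ Torus} (hT : IsAnalyticDiffeo T) (α : ℝ) {φ : ℂ → ℂ}
    (h : CircleHolo φ) : DiffTorus :=
  ⟨T.trans ((skewHomeo α h.circleMap).trans T.symm),
    hT.trans ((isAnalyticDiffeo_skewHomeo h α).trans hT.symm), by
      have := ((ContinuousMap.Homotopic.refl (T.symm : C(Torus, Torus))).comp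
        (skewHomeo_homotopic α h.circleMap)).comp
          (ContinuousMap.Homotopic.refl (T : C(Torus, Torus)))
      have e : ((T.symm : C(Torus, Torus)).comp (ContinuousMap.id Torus)).comp
          (T : C(Torus, Torus)) = ContinuousMap.id Torus := by
        ext p <;> simp
      rw [e] at this
      exact this⟩

lemma conjSkew_apply {T : Torus ≃ₜ Torus} (hT : IsAnalyticDiffeo T) (α : ℝ) {φ : ℂ → ℂ}
    (h : CircleHolo φ) (p : Torus) :
    (conjSkew hT α h).1 p = T.symm (skewHomeo α h.circleMap (T p)) := rfl

/-! ### Lifts of torus maps and their holomorphic extensions -/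

lemma eq_of_forall_exists_int {f : ℝ × ℝ → ℝ} (hf : Continuous f) (h : ∀ p, ∃ n : ℤ, f p = n) :
    ∃ n : ℤ, ∀ p, f p = n := by
  choose N hN using h
  have hc : Continuous N := by
    rw [Int.isClosedEmbedding_coe_real.isInducing.continuous_iff]
    convert hf using 1
    ext p; simp [hN]
  refine ⟨N 0, fun p => ?_⟩
  rw [hN, PreconnectedSpace.constant inferInstance hc]

lemma torusProj_eq_iff {p q : ℝ × ℝ} :
    torusProj p = torusProj q ↔ (∃ m : ℤ, p.1 - q.1 = m) ∧ ∃ n : ℤ, p.2 - q.2 = n := by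
  have h : ∀ x y : ℝ, (x : UnitAddCircle) = y ↔ ∃ m : ℤ, x - y = m := fun x y => by
    rw [← sub_eq_zero, ← AddCircle.coe_sub, AddCircle.coe_eq_zero_iff]
    simp [eq_comm]
  simp [torusProj, Prod.ext_iff, h]

/-- Two lifts of the same map differ by an integer vector. -/
lemma exists_int_of_torusProj_eq {L M : ℝ × ℝ → ℝ × ℝ} (hL : Continuous L) (hM : Continuous M)
    (h : ∀ p, torusProj (L p) = torusProj (M p)) :
    ∃ m n : ℤ, ∀ p, L p = ((M p).1 + m, (M p).2 + n) := by
  simp only [torusProj_eq_iff] at h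
  obtain ⟨m, hm⟩ := eq_of_forall_exists_int (f := fun p => (L p).1 - (M p).1) (by fun_prop)
    fun p => (h p).1
  obtain ⟨n, hn⟩ := eq_of_forall_exists_int (f := fun p => (L p).2 - (M p).2) (by fun_prop)
    fun p => (h p).2
  exact ⟨m, n, fun p => Prod.ext (by simp [← hm p]) (by simp [← hn p])⟩

lemma torusProj_add_one_fst (x y : ℝ) : torusProj (x + 1, y) = torusProj (x, y) :=
  torusProj_eq_iff.2 ⟨⟨1, by simp⟩, ⟨0, by simp⟩⟩

lemma torusProj_add_one_snd (x y : ℝ) : torusProj (x, y + 1) = torusProj (x, y) :=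
  torusProj_eq_iff.2 ⟨⟨0, by simp⟩, ⟨1, by simp⟩⟩

/-- A real-analytic lift together with its holomorphic extension to a strip. -/
structure ComplexLift (F : Torus → Torus) (L : ℝ × ℝ → ℝ × ℝ) (Λ : ℂ × ℂ → ℂ × ℂ) (ρ : ℝ)
    (K : NNReal) : Prop where
  pos : 0 < ρ
  continuous : Continuous L
  proj : ∀ p, torusProj (L p) = F (torusProj p)
  holo : DifferentiableOn ℂ Λ (strip ρ)
  ext : ∀ p, Λ (complexPoint p) = complexPoint (L p)
  lipschitz : LipschitzOnWith K Λ (strip ρ)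
  shift_fst : ∃ m n : ℤ, ∀ x y, L (x + 1, y) = ((L (x, y)).1 + m, (L (x, y)).2 + n)
  shift_snd : ∃ m n : ℤ, ∀ x y, L (x, y + 1) = ((L (x, y)).1 + m, (L (x, y)).2 + n)

theorem IsAnalyticTorusMap.exists_complexLift {F : Torus → Torus} (hF : IsAnalyticTorusMap F) :
    ∃ L Λ ρ K, ComplexLift F L Λ ρ K := by
  obtain ⟨L, hL, hLF⟩ := hF
  have hc : Continuous L := continuousOn_univ.1 hL.continuousOn
  obtain ⟨m, n, h1⟩ := exists_int_of_torusProj_eq (L := fun p => L (p.1 + 1, p.2)) (M := L)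
    (by fun_prop) hc fun p => by rw [hLF, hLF, torusProj_add_one_fst]
  obtain ⟨m', n', h2⟩ := exists_int_of_torusProj_eq (L := fun p => L (p.1, p.2 + 1)) (M := L)
    (by fun_prop) hc fun p => by rw [hLF, hLF, torusProj_add_one_snd]
  have q1 : QuasiPeriodic (fun p => (L p).1) m m' :=
    ⟨fun x y => by simp [h1 (x, y)], fun x y => by simp [h2 (x, y)]⟩
  have q2 : QuasiPeriodic (fun p => (L p).2) n n' :=
    ⟨fun x y => by simp [h1 (x, y)], fun x y => by simp [h2 (x, y)]⟩
  obtain ⟨ρ₁, hρ₁, Φ₁, hd₁, he₁, K₁, hK₁⟩ := q1.exists_lipschitz_extension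
    (fun p hp => analyticAt_fst.comp (hL p hp))
  obtain ⟨ρ₂, hρ₂, Φ₂, hd₂, he₂, K₂, hK₂⟩ := q2.exists_lipschitz_extension
    (fun p hp => analyticAt_snd.comp (hL p hp))
  have s1 := strip_mono (min_le_left ρ₁ ρ₂)
  have s2 := strip_mono (min_le_right ρ₁ ρ₂)
  exact ⟨L, fun z => (Φ₁ z, Φ₂ z), min ρ₁ ρ₂, max K₁ K₂,
    { pos := lt_min hρ₁ hρ₂
      continuous := hc
      proj := hLF
      holo := (hd₁.mono s1).prodMk (hd₂.mono s2)
      ext := fun p => Prod.ext (he₁ p) (he₂ p)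
      lipschitz := (hK₁.mono s1).prodMk (hK₂.mono s2)
      shift_fst := ⟨m, n, fun x y => h1 (x, y)⟩
      shift_snd := ⟨m', n', fun x y => h2 (x, y)⟩ }⟩

lemma ComplexLift.shift_sub {F : Torus → Torus} {L : ℝ × ℝ → ℝ × ℝ} {Λ : ℂ × ℂ → ℂ × ℂ} {ρ : ℝ}
    {K : NNReal} (h : ComplexLift F L Λ ρ K) (m n : ℤ) (v w : ℝ × ℝ) :
    L (v.1 + m, v.2 + n) - L v = L (w.1 + m, w.2 + n) - L w := by
  obtain ⟨a, b, h1⟩ := h.shift_fst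
  obtain ⟨a', b', h2⟩ := h.shift_snd
  have q1 : QuasiPeriodic (fun p => (L p).1) a a' := ⟨fun x y => by simp [h1], fun x y => by simp [h2]⟩
  have q2 : QuasiPeriodic (fun p => (L p).2) b b' := ⟨fun x y => by simp [h1], fun x y => by simp [h2]⟩
  ext
  · simp [q1.add_int]
  · simp [q2.add_int]

/-- Conjugating a skew product by a lift and a lift of the inverse gives a map commuting with the
integer translations that the first lift turns into integer translations. -/
lemma ComplexLift.conj_shift {F : Torus → Torus} {L : ℝ × ℝ → ℝ × ℝ} {Λ : ℂ × ℂ → ℂ × ℂ} {ρ : ℝ}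
    {K : NNReal} (h : ComplexLift F L Λ ρ K) {f : ℝ → ℝ} (hf : Function.Periodic f 1) (α : ℝ)
    (m n : ℤ) (w : ℝ × ℝ) :
    L (skewLift α f (w.1 + m, w.2 + n)) - L (skewLift α f w) = L (w.1 + m, w.2 + n) - L w := by
  rw [← h.shift_sub m n (skewLift α f w) w]
  congr 2
  have := hf.int_mul m w.1
  rw [mul_one] at this
  simp only [skewLift, this]
  ext <;> simp <;> ring

/-! ### Continuity of conjugation in the inductive limit topology -/

section Conj

variable {T : Torus ≃ₜ Torus} (hT : IsAnalyticDiffeo T)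
  {L M : ℝ × ℝ → ℝ × ℝ} {Λ Ω : ℂ × ℂ → ℂ × ℂ} {ρ σ : ℝ} {K J : NNReal}

/-- The displacement of the complexified lift of a conjugate of a skew product. -/
def conjDisplacement (Λ Ω : ℂ × ℂ → ℂ × ℂ) (α : ℝ) (φ : ℂ → ℂ) :
    (ℂ × ℂ → ℂ) × (ℂ × ℂ → ℂ) :=
  (fun z => (Ω (skewComplex α φ (Λ z))).1 - z.1, fun z => (Ω (skewComplex α φ (Λ z))).2 - z.2)

/-- The conjugacy T need not be homotopic to the identity, so L may turn unit translations into
other integer vectors. As M ∘ L is an integer translation, M turns them back. -/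
lemma conj_lift_add_one (hL : ComplexLift T L Λ ρ K) (hM : ComplexLift T.symm M Ω σ J)
    {f : ℝ → ℝ} (hf : Function.Periodic f 1) (α x y : ℝ) :
    M (skewLift α f (L (x + 1, y))) = M (skewLift α f (L (x, y))) + (1, 0) ∧
    M (skewLift α f (L (x, y + 1))) = M (skewLift α f (L (x, y))) + (0, 1) := by
  obtain ⟨a, b, hab⟩ := exists_int_of_torusProj_eq (L := M ∘ L) (M := id)
    (hM.continuous.comp hL.continuous) continuous_id (fun p => by
      simp [hM.proj, hL.proj])
  have hab' : ∀ p, M (L p) = (p.1 + (a : ℝ), p.2 + (b : ℝ)) := hab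
  obtain ⟨m, n, h1⟩ := hL.shift_fst
  obtain ⟨m', n', h2⟩ := hL.shift_snd
  have e1 := hM.conj_shift hf α m n (L (x, y))
  have e2 := hM.conj_shift hf α m' n' (L (x, y))
  rw [← h1, hab', hab'] at e1
  rw [← h2, hab', hab'] at e2
  constructor
  · rw [sub_eq_iff_eq_add'.1 e1]; congr 1; ext <;> simp
  · rw [sub_eq_iff_eq_add'.1 e2]; congr 1; ext <;> simp

/-- Holomorphy holds on the strip of width r; boundedness comes from periodicity and compactness, at
the price of passing to s < r. -/
lemma isStripLift_conjDisplacement (hL : ComplexLift T L Λ ρ K)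
    (hM : ComplexLift T.symm M Ω σ J) (α : ℝ) {φ : ℂ → ℂ} (h : CircleHolo φ) {r s : ℝ}
    (hs0 : 0 < s) (hsr : s < r) (hrρ : r ≤ ρ) (h1 : ∀ z ∈ strip r, (Λ z).1 ∈ lineStrip 1)
    (h2 : ∀ z ∈ strip r, skewComplex α φ (Λ z) ∈ strip σ) :
    IsStripLift s (conjDisplacement Λ Ω α φ) (conjSkew hT α h) := by
  set f : ℝ → ℝ := fun x => (φ x).re with hf
  have hr0 : 0 < r := hs0.trans hsr
  have hΛ := hL.holo.mono (strip_mono hrρ)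
  have hsk : DifferentiableOn ℂ (fun z => skewComplex α φ (Λ z)) (strip r) :=
    (hΛ.fst.add_const _).prodMk (hΛ.snd.add (h.holo.comp hΛ.fst h1))
  have hΩ : DifferentiableOn ℂ (fun z => Ω (skewComplex α φ (Λ z))) (strip r) :=
    hM.holo.comp hsk h2
  have hreal : ∀ x y : ℝ, Ω (skewComplex α φ (Λ (x, y))) =
      complexPoint (M (skewLift α f (L (x, y)))) := fun x y => by
    have e := hL.ext (x, y)
    simp only [complexPoint] at e
    rw [e, ← hM.ext, ← skewComplex_complexPoint h]
    rfl
  have d1 : DifferentiableOn ℂ (conjDisplacement Λ Ω α φ).1 (strip r) :=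
    hΩ.fst.sub (by fun_prop)
  have d2 : DifferentiableOn ℂ (conjDisplacement Λ Ω α φ).2 (strip r) :=
    hΩ.snd.sub (by fun_prop)
  have real1 : ∀ x y : ℝ, (conjDisplacement Λ Ω α φ).1 (x, y) =
      ((M (skewLift α f (L (x, y)))).1 - x : ℝ) := fun x y => by
    simp [conjDisplacement, hreal, complexPoint]
  have real2 : ∀ x y : ℝ, (conjDisplacement Λ Ω α φ).2 (x, y) =
      ((M (skewLift α f (L (x, y)))).2 - y : ℝ) := fun x y => by
    simp [conjDisplacement, hreal, complexPoint]
  have per := conj_lift_add_one hL hM h.periodic_re α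
  have mem : ∀ g : ℂ × ℂ → ℂ, DifferentiableOn ℂ g (strip r) →
      (∀ x y : ℝ, g ((x + 1 : ℝ), y) = g (x, y)) → (∀ x y : ℝ, g (x, (y + 1 : ℝ)) = g (x, y)) →
      (∀ x y : ℝ, (g (x, y)).im = 0) → MemCOmega s g := by
    intro g hg p1 p2 hre
    have p1' : ∀ z ∈ strip r, g (z.1 + 1, z.2) = g z := fun z hz => by
      have := quasiPeriodic_fst_on_strip hr0 hg (a := 0) (fun x y => by simpa using p1 x y) hz
      simpa using this
    have p2' : ∀ z ∈ strip r, g (z.1, z.2 + 1) = g z := fun z hz => by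
      have := quasiPeriodic_snd_on_strip hr0 hg (a := 0) (fun x y => by simpa using p2 x y) hz
      simpa using this
    obtain ⟨B, hB⟩ := exists_bound_of_periodic hsr hg.continuousOn p1' p2'
    have hsub := strip_mono hsr.le
    refine ⟨hg.mono hsub, ?_, fun z hz => p1' z (hsub hz), fun z hz => p2' z (hsub hz), hre⟩
    refine (iSup₂_le fun z hz => ?_).trans_lt (ENNReal.ofReal_lt_top (r := B))
    rw [← ofReal_norm]
    exact ENNReal.ofReal_le_ofReal (hB z hz)
  refine ⟨mem _ d1 (fun x y => ?_) (fun x y => ?_) (fun x y => ?_),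
    mem _ d2 (fun x y => ?_) (fun x y => ?_) (fun x y => ?_), fun x y => ?_⟩
  · rw [real1, real1, (per x y).1]; simp [f]
  · rw [real1, real1, (per x y).2]; simp [f]
  · rw [real1, Complex.ofReal_im]
  · rw [real2, real2, (per x y).1]; simp [f]
  · rw [real2, real2, (per x y).2]; simp [f]
  · rw [real2, Complex.ofReal_im]
  · rw [real1, real2, conjSkew_apply, ← hL.proj, skewHomeo_torusProj, ← hM.proj]
    simp [f]

/-- Each point of the strip is within r of its real part, where Λ is real; the Lipschitz bound does
the rest. -/
lemma ComplexLift.abs_im_le {F : Torus → Torus} (hL : ComplexLift F L Λ ρ K) {r : ℝ}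
    (hrρ : r ≤ ρ) {z : ℂ × ℂ} (hz : z ∈ strip r) :
    |(Λ z).1.im| ≤ K * r ∧ |(Λ z).2.im| ≤ K * r := by
  have h0 := hL.lipschitz.dist_le_mul z (strip_mono hrρ hz) (complexPoint (rePoint z))
    (complexPoint_mem_strip hL.pos _)
  have hzr : dist z (complexPoint (rePoint z)) ≤ r := (mem_ball_rePoint.2 hz).le
  have h1 : dist (Λ z) (Λ (complexPoint (rePoint z))) ≤ K * r := h0.trans (by gcongr)
  have h3 : ∀ (w : ℂ) (x : ℝ), |w.im| ≤ dist w x := fun w x => by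
    rw [dist_eq_norm]; simpa using Complex.abs_im_le_norm (w - x)
  rw [hL.ext] at h1
  exact ⟨(h3 _ _).trans ((le_max_left _ _).trans h1), (h3 _ _).trans ((le_max_right _ _).trans h1)⟩

/-- Conjugates of skew products depend continuously on the fibre displacement. -/
theorem exists_forall_conjSkew_mem {φ : ℂ → ℂ} (h : CircleHolo φ)
    (hb : ∀ z ∈ lineStrip 1, ‖φ z‖ ≤ 1) (α : ℝ) {O : Set DiffTorus} (hO : IsOpen O)
    (hφO : conjSkew hT α h ∈ O) :
    ∃ η > 0, ∀ ψ : ℂ → ℂ, ∀ hψ : CircleHolo ψ, (∀ z ∈ lineStrip 1, ‖ψ z - φ z‖ ≤ η) →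
      conjSkew hT α hψ ∈ O := by
  obtain ⟨L, Λ, ρ, K, hL⟩ := hT.1.exists_complexLift
  obtain ⟨M, Ω, σ, J, hM⟩ := hT.2.exists_complexLift
  have hσ := hM.pos
  -- The bound 1/2 makes `CircleHolo.abs_im_le` available. The bound σ/6 keeps the image in the
  -- strip of Ω: the imaginary part in the fibre is at most Kr + 2Kr + σ/2 < σ.
  obtain ⟨r, hr0, hrρ, hKr⟩ : ∃ r > 0, r ≤ ρ ∧ K * r < min (1 / 2) (σ / 6) := by
    have hm : 0 < min (1 / 2) (σ / 6) := lt_min (by norm_num) (by positivity)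
    refine ⟨min ρ (min (1 / 2) (σ / 6) / (K + 1)), lt_min hL.pos (by positivity), min_le_left _ _, ?_⟩
    calc (K : ℝ) * min ρ (min (1 / 2) (σ / 6) / (K + 1)) ≤ K * (min (1 / 2) (σ / 6) / (K + 1)) := by
          gcongr; exact min_le_right _ _
      _ < (K + 1) * (min (1 / 2) (σ / 6) / (K + 1)) := by
          gcongr; linarith
      _ = _ := by field_simp
  have hK1 : K * r < 1 / 2 := hKr.trans_le (min_le_left _ _)
  have hK2 : K * r < σ / 6 := hKr.trans_le (min_le_right _ _)
  have mem1 : ∀ z ∈ strip r, (Λ z).1 ∈ lineStrip (1 / 2) := fun z hz =>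
    (hL.abs_im_le hrρ hz).1.trans_lt hK1
  have mem1' : ∀ z ∈ strip r, (Λ z).1 ∈ lineStrip 1 := fun z hz =>
    (show |(Λ z).1.im| < 1 / 2 from mem1 z hz).trans (by norm_num : (1 / 2 : ℝ) < 1)
  have mem2 : ∀ ψ : ℂ → ℂ, (∀ z ∈ lineStrip 1, ‖ψ z - φ z‖ ≤ σ / 2) →
      ∀ z ∈ strip r, skewComplex α ψ (Λ z) ∈ strip σ := by
    intro ψ hψ z hz
    obtain ⟨i1, i2⟩ := hL.abs_im_le hrρ hz
    have i3 := h.abs_im_le hb (mem1 z hz)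
    have i4 : |(ψ (Λ z).1).im - (φ (Λ z).1).im| ≤ σ / 2 := by
      simpa using (Complex.abs_im_le_norm _).trans (hψ _ (mem1' z hz))
    constructor
    · simp only [skewComplex, Complex.add_im, Complex.ofReal_im, add_zero]
      linarith
    · simp only [skewComplex, Complex.add_im]
      rw [abs_le] at i1 i2 i4
      rw [abs_lt]
      have i5 := abs_le.1 (i3.trans (mul_le_mul_of_nonneg_left (abs_le.2 i1) zero_le_two))
      constructor <;> linarith [i5.1, i5.2, i4.1, i4.2, i2.1, i2.2]
  have hr2 : 0 < r / 2 := half_pos hr0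
  have lift : ∀ ψ : ℂ → ℂ, ∀ hψ : CircleHolo ψ, (∀ z ∈ lineStrip 1, ‖ψ z - φ z‖ ≤ σ / 2) →
      IsStripLift (r / 2) (conjDisplacement Λ Ω α ψ) (conjSkew hT α hψ) := fun ψ hψ hc =>
    isStripLift_conjDisplacement hT hL hM α hψ hr2 (half_lt_self hr0) hrρ mem1' (mem2 ψ hc)
  have hφc : ∀ z ∈ lineStrip 1, ‖φ z - φ z‖ ≤ σ / 2 := fun z _ => by simp; positivity
  have liftφ := lift φ h hφc
  obtain ⟨ε, hε, hεO⟩ := hO (r / 2) hr2 _ ⟨hφO, ⟨_, liftφ⟩⟩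
  obtain ⟨ε', hε'0, hε'⟩ := ENNReal.lt_iff_exists_nnreal_btwn.1 hε
  have hε'0 : 0 < (ε' : ℝ) := by exact_mod_cast hε'0
  -- The first bound keeps the perturbed skew product in the domain of Ω; the second is multiplied
  -- by the Lipschitz constant J of Ω.
  refine ⟨min (σ / 2) (ε' / (J + 1)), lt_min (by positivity) (by positivity), fun ψ hψ hc => ?_⟩
  have liftψ := lift ψ hψ fun z hz => (hc z hz).trans (min_le_left _ _)
  refine hεO _ ⟨_, liftψ⟩ (lt_of_le_of_lt ?_ hε')
  refine (iInf₂_le_of_le _ _ (iInf₂_le_of_le liftφ liftψ le_rfl)).trans ?_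
  have hdist : ∀ z ∈ strip (r / 2),
      dist (Ω (skewComplex α φ (Λ z))) (Ω (skewComplex α ψ (Λ z))) ≤ ε' := by
    intro z hz
    have hz' := strip_mono (half_le_self hr0.le) hz
    have d := hM.lipschitz.dist_le_mul _ (mem2 φ hφc z hz') _
      (mem2 ψ (fun z hz => (hc z hz).trans (min_le_left _ _)) z hz')
    have d' : dist (skewComplex α φ (Λ z)) (skewComplex α ψ (Λ z)) ≤ ε' / (J + 1) := by
      simp only [skewComplex, Prod.dist_eq, dist_self, dist_add_left]
      refine max_le (by positivity) ?_
      rw [dist_comm, dist_eq_norm]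
      exact (hc _ (mem1' z hz')).trans (min_le_right _ _)
    calc _ ≤ J * (ε' / (J + 1) : ℝ) := d.trans (by gcongr)
      _ ≤ (J + 1) * (ε' / (J + 1) : ℝ) := by gcongr; linarith
      _ = ε' := by field_simp
  have hnorm : ∀ w : ℂ, ‖w‖ ≤ ε' → ‖w‖ₑ ≤ ε' := fun w hw => by
    rw [← ofReal_norm, ← ENNReal.ofReal_coe_nnreal]
    exact ENNReal.ofReal_le_ofReal hw
  refine max_le (iSup₂_le fun z hz => hnorm _ ?_) (iSup₂_le fun z hz => hnorm _ ?_)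
  · simp only [conjDisplacement, Pi.sub_apply, sub_sub_sub_cancel_right]
    rw [← dist_eq_norm]
    exact (le_max_left _ _).trans (hdist z hz)
  · simp only [conjDisplacement, Pi.sub_apply, sub_sub_sub_cancel_right]
    rw [← dist_eq_norm]
    exact (le_max_right _ _).trans (hdist z hz)

end Conj

/-! ### Entire periodic functions and peaked trigonometric polynomials -/

/-- Entire functions that are `1`-periodic and real on the real line. -/
structure EntirePeriodic (g : ℂ → ℂ) : Prop where
  entire : Differentiable ℂ g
  periodic : Function.Periodic g 1
  real : ∀ x : ℝ, (g x).im = 0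

namespace EntirePeriodic

variable {g u : ℂ → ℂ}

lemma circleHolo (h : EntirePeriodic g) : CircleHolo g :=
  ⟨h.entire.differentiableOn, fun x => h.periodic x, h.real⟩

lemma zero : EntirePeriodic 0 := ⟨differentiable_const 0, fun _ => rfl, fun _ => by simp⟩

lemma add (h : EntirePeriodic g) (h' : EntirePeriodic u) : EntirePeriodic (g + u) :=
  ⟨h.entire.add h'.entire, h.periodic.add h'.periodic, fun x => by simp [h.real, h'.real]⟩

/-- The coboundary `g(z + α) - g(z)`. -/
lemma coboundary (h : EntirePeriodic g) (α : ℝ) : EntirePeriodic (fun z => g (z + α) - g z) := by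
  refine ⟨(h.entire.comp (differentiable_id.add_const _)).sub h.entire, fun z => ?_, fun x => ?_⟩
  · simp only [h.periodic z, add_right_comm z 1, h.periodic (z + α)]
  · have := h.real (x + α)
    push_cast at this
    simp [this, h.real]

lemma exists_lipschitz (h : EntirePeriodic g) (R : ℝ) :
    ∃ B > 0, ∀ z ∈ lineStrip R, ∀ θ : ℝ, ‖g (z + θ) - g z‖ ≤ B * |θ| := by
  have hper : ∀ z, deriv g (z + 1) = deriv g z := fun z => by
    rw [← deriv_comp_add_const]
    congr 1
    funext w
    exact h.periodic w
  have hcont : Continuous (deriv g) := (h.entire.contDiff (n := 1)).continuous_deriv le_rfl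
  obtain ⟨M, hM⟩ := exists_bound_of_periodic (ρ := R + 1) (r := R) (by linarith)
    (Ψ := fun z : ℂ × ℂ => deriv g z.1) (hcont.comp continuous_fst).continuousOn
    (fun z _ => hper z.1) (fun z _ => rfl)
  refine ⟨max M 1, by positivity, fun z hz θ => ?_⟩
  have hb : ∀ w ∈ lineStrip R, ‖deriv g w‖ ≤ max M 1 := fun w hw =>
    (hM (w, w) ⟨hw, hw⟩).trans (le_max_left _ _)
  have := (convex_lineStrip R).norm_image_sub_le_of_norm_deriv_le
    (fun w _ => h.entire w) hb hz (y := z + θ) (by simpa [lineStrip] using hz)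
  simpa using this

lemma exists_lipschitz_real (h : EntirePeriodic g) :
    ∃ B > 0, ∀ x y : ℝ, |(g x).re - (g y).re| ≤ B * |x - y| := by
  obtain ⟨B, hB, hl⟩ := h.exists_lipschitz 1
  refine ⟨B, hB, fun x y => ?_⟩
  have := hl y (ofReal_mem_lineStrip one_pos y) (x - y)
  push_cast at this
  rw [add_sub_cancel] at this
  simpa using (Complex.abs_re_le_norm _).trans this

lemma re_add_int (h : EntirePeriodic g) (x : ℝ) (j : ℤ) : (g ((x + j : ℝ) : ℂ)).re = (g x).re := by
  have := h.periodic.int_mul j x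
  rw [mul_one] at this
  push_cast
  rw [this]

end EntirePeriodic

/-- The peaked trigonometric polynomial `((1 + cos 2πz) / 2) ^ n`. -/
noncomputable def bump (n : ℕ) (z : ℂ) : ℂ := ((1 + Complex.cos (2 * Real.pi * z)) / 2) ^ n

lemma bump_ofReal (n : ℕ) (x : ℝ) :
    bump n x = (((1 + Real.cos (2 * Real.pi * x)) / 2) ^ n : ℝ) := by
  simp [bump]

lemma entirePeriodic_bump (n : ℕ) : EntirePeriodic (bump n) := by
  refine ⟨by unfold bump; fun_prop, fun z => ?_, fun x => ?_⟩
  · simp only [bump, mul_add, mul_one, Complex.cos_add_two_pi]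
  · rw [bump_ofReal, Complex.ofReal_im]

lemma bump_base_mem (x : ℝ) : (1 + Real.cos (2 * Real.pi * x)) / 2 ∈ Icc (0 : ℝ) 1 :=
  ⟨by linarith [Real.neg_one_le_cos (2 * Real.pi * x)],
    by linarith [Real.cos_le_one (2 * Real.pi * x)]⟩

lemma bump_re_nonneg (n : ℕ) (x : ℝ) : 0 ≤ (bump n x).re := by
  rw [bump_ofReal, Complex.ofReal_re]
  exact pow_nonneg (bump_base_mem x).1 n

lemma exists_bump_eq {n : ℕ} (hn : n ≠ 0) {c : ℝ} (hc : c ∈ Icc (0 : ℝ) 1) :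
    ∃ t : ℝ, (bump n t).re = c := by
  have h0 : (bump n (0 : ℝ)).re = 1 := by rw [bump_ofReal]; simp
  have h1 : (bump n (1 / 2 : ℝ)).re = 0 := by
    rw [bump_ofReal, show 2 * Real.pi * (1 / 2) = Real.pi by ring]; simp [hn]
  have := intermediate_value_univ (1 / 2) 0 (entirePeriodic_bump n).circleHolo.continuous_re
  simp only [h0, h1] at this
  exact this hc

lemma entirePeriodic_bump_mul (n q : ℕ) : EntirePeriodic (fun z => bump n (q * z)) := by
  have h := entirePeriodic_bump n
  refine ⟨h.entire.comp (by fun_prop), fun z => ?_, fun x => ?_⟩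
  · have := h.periodic.nat_mul q (q * z)
    simpa [mul_add] using this
  · have := h.real (q * x)
    push_cast at this
    exact this

/-- A Lipschitz constant of `bump n` along real directions in the strip `{|Im z| < q}`. -/
noncomputable def bumpLip (n q : ℕ) : ℝ := ((entirePeriodic_bump n).exists_lipschitz q).choose

lemma bumpLip_pos (n q : ℕ) : 0 < bumpLip n q :=
  ((entirePeriodic_bump n).exists_lipschitz q).choose_spec.1

lemma bumpLip_spec (n q : ℕ) {z : ℂ} (hz : z ∈ lineStrip q) (θ : ℝ) :
    ‖bump n (z + θ) - bump n z‖ ≤ bumpLip n q * |θ| :=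
  ((entirePeriodic_bump n).exists_lipschitz q).choose_spec.2 z hz θ

/-! ### Extremely well approximable angles -/

/-- Numbers with a rational approximation of denominator at least `n` so good that the coboundary
of `bump n (q z)` is at most `1 / (n + 1)`. -/
def wellApprox (n : ℕ) : Set ℝ :=
  ⋃ q ∈ {q : ℕ | n ≤ q ∧ 0 < q}, ⋃ p : ℤ, {α | |q * α - p| < 1 / ((n + 1) * bumpLip n q)}

lemma isOpen_wellApprox (n : ℕ) : IsOpen (wellApprox n) :=
  isOpen_biUnion fun _ _ => isOpen_iUnion fun _ => isOpen_lt (by fun_prop) continuous_const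

/-- Every fraction p/q with q ≥ max(n, 1) belongs to the set, because qα - p vanishes there. -/
lemma dense_wellApprox (n : ℕ) : Dense (wellApprox n) := by
  rw [Metric.dense_iff]
  intro x ε hε
  obtain ⟨m, hm⟩ := exists_nat_one_div_lt hε
  let q : ℕ := n + m + 1
  have hq : (0 : ℝ) < q := by positivity
  refine ⟨(⌊x * q⌋ : ℝ) / q, ?_, ?_⟩
  · have h1 := Int.floor_le (x * q)
    have h2 := Int.lt_floor_add_one (x * q)
    have h3 : 1 / (q : ℝ) ≤ 1 / (m + 1) := by
      apply one_div_le_one_div_of_le (by positivity)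
      simp only [q]; push_cast; linarith [Nat.cast_nonneg (α := ℝ) n]
    have h4 : x - ⌊x * q⌋ / q = (x * q - ⌊x * q⌋) / q := by field_simp
    rw [Metric.mem_ball, dist_comm, Real.dist_eq, h4, abs_of_nonneg (by
      apply div_nonneg _ hq.le; linarith)]
    refine lt_of_le_of_lt ?_ (h3.trans_lt hm)
    gcongr
    linarith
  · refine mem_iUnion₂.2 ⟨q, ⟨by simp only [q]; omega, by simp only [q]; omega⟩,
      mem_iUnion.2 ⟨⌊x * q⌋, ?_⟩⟩
    have : (q : ℝ) * (⌊x * q⌋ / q) - ⌊x * q⌋ = 0 := by field_simp; ring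
    simp only [mem_ofPred_eq, this, abs_zero]
    have := bumpLip_pos n q
    positivity

/-- The set of rotation numbers: irrational and extremely well approximable. -/
def goodAngles : Set ℝ := {α | Irrational α} ∩ ⋂ n, wellApprox n

lemma isGδ_goodAngles : IsGδ goodAngles :=
  IsGδ.setOfPred_irrational.inter (IsGδ.iInter_of_isOpen isOpen_wellApprox)

lemma dense_goodAngles : Dense goodAngles :=
  dense_irrational.inter_of_Gδ IsGδ.setOfPred_irrational (IsGδ.iInter_of_isOpen isOpen_wellApprox)
    (dense_iInter_of_isOpen isOpen_wellApprox dense_wellApprox)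

/-- By periodicity the shift qα may be replaced by qα - p, which was required to be small against
the Lipschitz constant on the strip of width q, where qz lies. -/
lemma exists_small_coboundary {α : ℝ} (hα : α ∈ goodAngles) (n : ℕ) :
    ∃ q : ℕ, n ≤ q ∧ 0 < q ∧
      ∀ z ∈ lineStrip 1, ‖bump n (q * (z + α)) - bump n (q * z)‖ ≤ 1 / (n + 1) := by
  obtain ⟨q, ⟨hnq, hq⟩, h⟩ := mem_iUnion₂.1 (mem_iInter.1 hα.2 n)
  obtain ⟨p, hp⟩ := mem_iUnion.1 h
  refine ⟨q, hnq, hq, fun z hz => ?_⟩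
  have hq0 : (0 : ℝ) < q := by exact_mod_cast hq
  have hz' : (q : ℂ) * z ∈ lineStrip q := by
    have : |z.im| < 1 := hz
    have e : ((q : ℂ) * z).im = q * z.im := by simp
    show |((q : ℂ) * z).im| < q
    rw [e, abs_mul, Nat.abs_cast]
    nlinarith
  have e : bump n (q * (z + α)) = bump n (q * z + (q * α - p : ℝ)) := by
    have := (entirePeriodic_bump n).periodic.int_mul p (q * z + (q * α - p : ℝ))
    rw [← this]; congr 1; push_cast; ring
  rw [e]
  refine (bumpLip_spec n q hz' _).trans ?_
  have hB := bumpLip_pos n q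
  calc _ ≤ bumpLip n q * (1 / ((n + 1) * bumpLip n q)) := by gcongr; exact hp.le
    _ = _ := by field_simp

/-! ### Integrals of the peaks -/

lemma volume_singleton_circle (a : UnitAddCircle) : volume {a} = 0 := by
  rw [← Metric.closedBall_zero, AddCircle.volume_closedBall]; simp

/-- Dominated convergence: the base of the power lies in [0, 1] and equals 1 only at the origin of
the circle. -/
lemma tendsto_lintegral_bump :
    Filter.Tendsto (fun n => ∫⁻ a, ENNReal.ofReal ((entirePeriodic_bump n).circleHolo.circleMap a))
      Filter.atTop (nhds 0) := by
  have hz : ∫⁻ _ : UnitAddCircle, (0 : ℝ≥0∞) = 0 := lintegral_zero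
  rw [← hz]
  refine tendsto_lintegral_of_dominated_convergence (fun _ => 1)
    (fun n => (ENNReal.continuous_ofReal.comp (map_continuous _)).measurable) (fun n => ?_)
    (by simp) ?_
  · refine Filter.Eventually.of_forall fun a => ?_
    obtain ⟨x, rfl⟩ := QuotientAddGroup.mk_surjective a
    have : (entirePeriodic_bump n).circleHolo.circleMap (x : UnitAddCircle) ≤ 1 := by
      rw [CircleHolo.circleMap_coe, bump_ofReal, Complex.ofReal_re]
      exact pow_le_one₀ (bump_base_mem x).1 (bump_base_mem x).2
    exact ENNReal.ofReal_le_one.2 this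
  · have h0 : ∀ᵐ a : UnitAddCircle, a ≠ 0 := by
      rw [ae_iff]; simpa using volume_singleton_circle 0
    filter_upwards [h0] with a ha
    obtain ⟨x, rfl⟩ := QuotientAddGroup.mk_surjective a
    have hlt : (1 + Real.cos (2 * Real.pi * x)) / 2 < 1 := by
      refine lt_of_le_of_ne (bump_base_mem x).2 fun h => ha ?_
      have hc : Real.cos (2 * Real.pi * x) = 1 := by linarith
      obtain ⟨k, hk⟩ := (Real.cos_eq_one_iff _).1 hc
      have hx : x = k := by
        have hpi := Real.pi_pos
        have : 2 * Real.pi * (k - x) = 0 := by linarith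
        rcases mul_eq_zero.1 this with h | h
        · linarith
        · linarith
      exact (AddCircle.coe_eq_zero_iff (p := (1 : ℝ))).2 ⟨k, by simp [hx]⟩
    have := ENNReal.tendsto_ofReal
      (tendsto_pow_atTop_nhds_zero_of_lt_one (bump_base_mem x).1 hlt)
    rw [ENNReal.ofReal_zero] at this
    refine this.congr fun n => ?_
    have : (entirePeriodic_bump n).circleHolo.circleMap (x : UnitAddCircle) = _ :=
      CircleHolo.circleMap_coe _ x
    rw [bump_ofReal, Complex.ofReal_re] at this
    exact congrArg ENNReal.ofReal this.symm

lemma measurePreserving_nsmul_circle {q : ℕ} (hq : 0 < q) :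
    MeasurePreserving (fun a : UnitAddCircle => q • a) volume volume := by
  rcases Nat.lt_or_ge 1 q with h | h
  · exact (AddCircle.ergodic_nsmul h).toMeasurePreserving
  · obtain rfl : q = 1 := by omega
    simp only [one_smul]
    exact MeasurePreserving.id _

/-- Multiplication by q preserves Lebesgue measure, so n alone controls the integral and q can be
chosen afterwards. -/
lemma lintegral_bump_mul (n : ℕ) {q : ℕ} (hq : 0 < q) :
    ∫⁻ a, ENNReal.ofReal ((entirePeriodic_bump_mul n q).circleHolo.circleMap a) =
      ∫⁻ a, ENNReal.ofReal ((entirePeriodic_bump n).circleHolo.circleMap a) := by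
  have hm : Measurable fun a => ENNReal.ofReal ((entirePeriodic_bump n).circleHolo.circleMap a) :=
    ENNReal.measurable_ofReal.comp (map_continuous _).measurable
  rw [← (measurePreserving_nsmul_circle hq).lintegral_comp hm]
  refine lintegral_congr fun a => ?_
  obtain ⟨x, rfl⟩ := QuotientAddGroup.mk_surjective a
  have e : q • (x : UnitAddCircle) = ((q * x : ℝ) : UnitAddCircle) := by
    rw [← AddCircle.coe_nsmul, nsmul_eq_mul]
  have : (entirePeriodic_bump n).circleHolo.circleMap (q • (x : UnitAddCircle)) =
      (entirePeriodic_bump_mul n q).circleHolo.circleMap (x : UnitAddCircle) := by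
    rw [e, CircleHolo.circleMap_coe, CircleHolo.circleMap_coe]; simp
  exact congrArg ENNReal.ofReal this.symm

/-! ### Density of finite orbits -/

/-- Uniform density of finite orbits of an irrational rotation. -/
lemma exists_uniform_rotation {α : ℝ} (hα : Irrational α) {δ : ℝ} (hδ : 0 < δ) :
    ∃ N : ℕ, ∀ t : ℝ, ∃ n ≤ N, ∃ j : ℤ, |n * α - t - j| < δ := by
  have hd : DenseRange (fun n : ℤ => n • (α : UnitAddCircle)) :=
    AddCircle.denseRange_zsmul_coe_iff.2 (by simpa using hα)
  obtain ⟨s, hs⟩ := isCompact_univ.elim_finite_subcover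
    (fun n : ℤ => Metric.ball (n • (α : UnitAddCircle)) δ) (fun _ => Metric.isOpen_ball)
    (fun a _ => by
      obtain ⟨n, hn⟩ := hd.exists_dist_lt a hδ
      exact mem_iUnion.2 ⟨n, hn⟩)
  let N : ℕ := s.sup Int.natAbs
  refine ⟨2 * N, fun t => ?_⟩
  -- The cover uses times in [-N, N]; aiming at t - Nα shifts them to nonnegative times at most 2N.
  obtain ⟨n, hn, hb⟩ := mem_iUnion₂.1 (hs (mem_univ ((t - N * α : ℝ) : UnitAddCircle)))
  have hnN : n.natAbs ≤ N := Finset.le_sup hn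
  have hn0 : ((n + N).toNat : ℤ) = n + N := Int.toNat_of_nonneg (by omega)
  have hn0' : ((n + N).toNat : ℝ) = n + N := by exact_mod_cast hn0
  refine ⟨(n + N).toNat, by omega, round ((n + N) * α - t), ?_⟩
  rw [Metric.mem_ball, dist_comm, dist_eq_norm, ← AddCircle.coe_zsmul, ← AddCircle.coe_sub,
    AddCircle.norm_eq] at hb
  simp only [zsmul_eq_mul, inv_one, one_mul, mul_one] at hb
  rw [hn0']
  rwa [show (n : ℝ) * α - (t - N * α) = (n + N) * α - t by ring] at hb

/-- All orbits of length `N` of the skew product over `R_α` with the coboundary of `v` are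
`ε`-dense. -/
def DenseOrbits (α : ℝ) (v : ℂ → ℂ) (N : ℕ) (ε : ℝ) : Prop :=
  ∀ x y x' y' : ℝ, ∃ n ≤ N, ∃ j k : ℤ, |x + n * α - x' - j| < ε ∧
    |y + ((v ((x + n * α : ℝ) : ℂ)).re - (v x).re) - y' - k| < ε

lemma DenseOrbits.mono {α : ℝ} {v : ℂ → ℂ} {N N' : ℕ} {ε ε' : ℝ} (h : DenseOrbits α v N ε)
    (hN : N ≤ N') (hε : ε ≤ ε') : DenseOrbits α v N' ε' := fun x y x' y' => by
  obtain ⟨n, hn, j, k, h1, h2⟩ := h x y x' y'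
  exact ⟨n, hn.trans hN, j, k, h1.trans_le hε, h2.trans_le hε⟩

/-- Within distance 1/q of x' the peak function takes every value in [0, 1], in particular the
fractional part of the missing height, while u moves by at most B/q. -/
lemma exists_dense_graph {u : ℂ → ℂ} (hu : EntirePeriodic u) {ε : ℝ} (hε : 0 < ε) :
    ∃ n₀ : ℕ, ∀ n ≥ n₀, ∀ q ≥ n, ∀ x' y' : ℝ, ∃ x : ℝ, |x - x'| < ε ∧ ∃ k : ℤ,
      |((u + fun z => bump n (q * z)) x).re - y' - k| < ε := by
  obtain ⟨B, hB, hl⟩ := hu.exists_lipschitz_real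
  obtain ⟨m, hm⟩ := exists_nat_gt ((1 + B) / ε)
  refine ⟨m + 1, fun n hn q hq x' y' => ?_⟩
  have hq0 : (0 : ℝ) < q := by
    have : 0 < q := by omega
    exact_mod_cast this
  have hqm : (m : ℝ) ≤ q := by
    have : m ≤ q := by omega
    exact_mod_cast this
  have hqε : (1 + B) * (1 / q) < ε := by
    rw [mul_one_div, div_lt_comm₀ hq0 hε]
    exact hm.trans_le hqm
  obtain ⟨t, ht⟩ := exists_bump_eq (n := n) (by omega) (c := Int.fract (y' - (u x').re))
    ⟨Int.fract_nonneg _, (Int.fract_lt_one _).le⟩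
  let c : ℤ := ⌈q * x' - t⌉
  let x : ℝ := (t + c) / q
  have hx : |x - x'| ≤ 1 / q := by
    have e : x - x' = (c - (q * x' - t)) / q := by simp only [x]; field_simp; ring
    have h1 := Int.le_ceil (q * x' - t)
    have h2 := Int.ceil_lt_add_one (q * x' - t)
    rw [e, abs_div, abs_of_pos hq0]
    gcongr
    rw [abs_of_nonneg (by simp only [c]; linarith)]
    simp only [c]; linarith
  have hbx : (bump n (q * (x : ℂ))).re = Int.fract (y' - (u x').re) := by
    have e : (q : ℂ) * (x : ℂ) = ((t + c : ℝ) : ℂ) := by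
      simp only [x]; push_cast
      have : (q : ℂ) ≠ 0 := by exact_mod_cast hq0.ne'
      field_simp
    rw [e, (entirePeriodic_bump n).re_add_int, ht]
  refine ⟨x, ?_, -⌊y' - (u x').re⌋, ?_⟩
  · have : 0 ≤ B * (1 / q : ℝ) := by positivity
    linarith
  · simp only [Pi.add_apply, Complex.add_re, hbx]
    have e : (u x).re + Int.fract (y' - (u x').re) - y' - ((-⌊y' - (u x').re⌋ : ℤ) : ℝ) =
        (u x).re - (u x').re := by
      rw [← Int.self_sub_floor]; push_cast; ring
    rw [e]
    refine (hl x x').trans_lt ?_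
    have h1 : B * |x - x'| ≤ B * (1 / q) := by gcongr
    have h2 : 0 < 1 / (q : ℝ) := by positivity
    linarith

/-- The orbit of (x, y) lies on the graph of v translated vertically by y - v(x). That translate
passes near the target, and the rotation brings x close enough to the corresponding abscissa; the
Lipschitz bound on v costs a second ε. -/
lemma exists_denseOrbits {α : ℝ} (hα : Irrational α) {v : ℂ → ℂ} (hv : EntirePeriodic v) {ε : ℝ}
    (hε : 0 < ε) (h : ∀ x' y' : ℝ, ∃ x : ℝ, |x - x'| < ε ∧ ∃ k : ℤ, |(v x).re - y' - k| < ε) :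
    ∃ N, DenseOrbits α v N (2 * ε) := by
  obtain ⟨B, hB, hl⟩ := hv.exists_lipschitz_real
  obtain ⟨N, hN⟩ := exists_uniform_rotation hα (δ := ε / (1 + B)) (by positivity)
  refine ⟨N, fun x y x' y' => ?_⟩
  obtain ⟨x'', hx'', k, hk⟩ := h x' (y' - y + (v x).re)
  obtain ⟨n, hn, j, hj⟩ := hN (x'' - x)
  have hδ1 : ε / (1 + B) ≤ ε := div_le_self hε.le (by linarith)
  have hδ2 : B * (ε / (1 + B)) ≤ ε := by
    rw [mul_div_assoc', div_le_iff₀ (by positivity)]; nlinarith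
  have hl' := hl (x + n * α) (x'' + j)
  rw [hv.re_add_int] at hl'
  have e : x + n * α - (x'' + j) = n * α - (x'' - x) - j := by ring
  rw [e] at hl'
  have hl'' : |(v ((x + n * α : ℝ) : ℂ)).re - (v x'').re| ≤ ε :=
    hl'.trans ((mul_le_mul_of_nonneg_left hj.le hB.le).trans hδ2)
  refine ⟨n, hn, j, k, ?_, ?_⟩
  · rw [abs_lt] at *
    constructor <;> linarith [hj.1, hj.2, hx''.1, hx''.2]
  · rw [abs_lt] at hk ⊢
    rw [abs_le] at hl''
    constructor <;> linarith [hk.1, hk.2, hl''.1, hl''.2]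

/-- The inductive step: a small correction making all orbits dense at a given scale. -/
theorem exists_correction {α : ℝ} (hα : α ∈ goodAngles) {u : ℂ → ℂ} (hu : EntirePeriodic u)
    {ε : ℝ} (hε : 0 < ε) :
    ∃ g : ℂ → ℂ, ∃ hg : EntirePeriodic g, (∀ x : ℝ, 0 ≤ (g x).re) ∧
      ∫⁻ a, ENNReal.ofReal (hg.circleHolo.circleMap a) ≤ ENNReal.ofReal ε ∧
      (∀ z ∈ lineStrip 1, ‖g (z + α) - g z‖ ≤ ε) ∧ ∃ N, DenseOrbits α (u + g) N ε := by
  obtain ⟨n₀, hn₀⟩ := exists_dense_graph hu (half_pos hε)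
  obtain ⟨m, hm⟩ := exists_nat_one_div_lt hε
  obtain ⟨n₁, hn₁⟩ := Filter.eventually_atTop.1
    (tendsto_lintegral_bump.eventually (gt_mem_nhds (ENNReal.ofReal_pos.2 hε)))
  -- The three terms serve the density of the graph, the size 1/(n + 1) of the coboundary, and the
  -- integral. Only then is q supplied by the angle.
  let n := max n₀ (max m n₁)
  obtain ⟨q, hnq, hq, hc⟩ := exists_small_coboundary hα n
  refine ⟨fun z => bump n (q * z), entirePeriodic_bump_mul n q, fun x => ?_, ?_, ?_, ?_⟩
  · simpa using bump_re_nonneg n (q * x)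
  · rw [lintegral_bump_mul n hq]
    exact (hn₁ n ((le_max_right _ _).trans (le_max_right _ _))).le
  · intro z hz
    refine (hc z hz).trans (le_trans ?_ hm.le)
    have : (m : ℝ) ≤ n := by exact_mod_cast (le_max_left _ _).trans (le_max_right _ _)
    gcongr
  · obtain ⟨N, hN⟩ := exists_denseOrbits hα.1 (hu.add (entirePeriodic_bump_mul n q)) (half_pos hε)
      (hn₀ n (le_max_left _ _) q hnq)
    exact ⟨N, by rwa [mul_div_cancel₀ _ two_ne_zero] at hN⟩

/-! ### Inductive construction of the cocycle -/

/-- The displacement `φ` is the sum of the coboundaries of the functions `g i`, with partial sums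
`u i`, converging so fast that the density of the orbits at every scale survives in the limit. -/
structure LimitCocycle (α δ : ℝ) (φ : ℂ → ℂ) (g u : ℕ → ℂ → ℂ) (N : ℕ → ℕ) : Prop where
  circleHolo : CircleHolo φ
  entire_g : ∀ i, EntirePeriodic (g i)
  entire_u : ∀ i, EntirePeriodic (u i)
  nonneg : ∀ i, ∀ x : ℝ, 0 ≤ (g i x).re
  lintegral_le : ∀ i, ∫⁻ a, ENNReal.ofReal ((entire_g i).circleHolo.circleMap a) ≤
    ENNReal.ofReal (δ * (1 / 2) ^ i)
  hasSum : ∀ z ∈ lineStrip 1, HasSum (fun i => g i (z + α) - g i z) (φ z)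
  norm_le : ∀ z ∈ lineStrip 1, ‖φ z‖ ≤ 2 * δ
  denseOrbits : ∀ i, DenseOrbits α (u (i + 1)) (N (i + 1)) (δ * (1 / 2) ^ i)
  approx : ∀ i, ∀ z ∈ lineStrip 1, ‖(u (i + 1) (z + α) - u (i + 1) z) - φ z‖ ≤
    δ * (1 / 2) ^ i / (N (i + 1) + 1)

/-- Each correction is chosen after the time N of the current stage is known, and its coboundary is
small even when multiplied by N. The bounds hold on the whole unit strip, so the sum is holomorphic
there. -/
theorem exists_limitCocycle {α : ℝ} (hα : α ∈ goodAngles) {δ : ℝ} (hδ : 0 < δ) :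
    ∃ φ g u N, LimitCocycle α δ φ g u N := by
  have step : ∀ (u : {u : ℂ → ℂ // EntirePeriodic u}) (ε : {ε : ℝ // 0 < ε}),
      ∃ g : {g : ℂ → ℂ // EntirePeriodic g}, ∃ N : ℕ, (∀ x : ℝ, 0 ≤ (g.1 x).re) ∧
      ∫⁻ a, ENNReal.ofReal (g.2.circleHolo.circleMap a) ≤ ENNReal.ofReal ε ∧
      (∀ z ∈ lineStrip 1, ‖g.1 (z + α) - g.1 z‖ ≤ ε) ∧ DenseOrbits α (u.1 + g.1) N ε := by
    intro u ε
    obtain ⟨g, hg, h1, h2, h3, N, h4⟩ := exists_correction hα u.2 ε.2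
    exact ⟨⟨g, hg⟩, N, h1, h2, h3, h4⟩
  choose G NN h1 h2 h3 h4 using step
  -- The tolerance at stage i: geometric for summability, divided by N + 1 so that N steps of an
  -- orbit accumulate less than δ / 2 ^ i.
  let E : ℕ → ℕ → {ε : ℝ // 0 < ε} := fun i N => ⟨δ * (1 / 2) ^ i / (N + 1), by positivity⟩
  let st : ℕ → {u : ℂ → ℂ // EntirePeriodic u} × ℕ := fun i =>
    Nat.rec (⟨0, EntirePeriodic.zero⟩, 0)
      (fun i s => (⟨s.1.1 + (G s.1 (E i s.2)).1, s.1.2.add (G s.1 (E i s.2)).2⟩,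
        s.2 + NN s.1 (E i s.2))) i
  let u : ℕ → ℂ → ℂ := fun i => (st i).1.1
  let N : ℕ → ℕ := fun i => (st i).2
  let g : ℕ → ℂ → ℂ := fun i => (G (st i).1 (E i (N i))).1
  have hu : ∀ i, u (i + 1) = u i + g i := fun i => rfl
  have hNs : ∀ i, N (i + 1) = N i + NN (st i).1 (E i (N i)) := fun i => rfl
  -- The times are accumulated rather than replaced, so every later tolerance is also divided by at
  -- least the current N + 1.
  have hNmono : Monotone N := monotone_nat_of_le_succ fun i => by rw [hNs]; omega
  let a : ℕ → ℂ → ℂ := fun i z => g i (z + α) - g i z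
  have ha : ∀ i, ∀ z ∈ lineStrip 1, ‖a i z‖ ≤ δ * (1 / 2) ^ i / (N i + 1) := fun i =>
    h3 (st i).1 (E i (N i))
  have hle : ∀ i, δ * (1 / 2) ^ i / ((N i : ℝ) + 1) ≤ δ * (1 / 2) ^ i := fun i =>
    div_le_self (by positivity) (by linarith [Nat.cast_nonneg (α := ℝ) (N i)])
  have hgeo : ∀ c : ℝ, HasSum (fun i : ℕ => c * (1 / 2 : ℝ) ^ i) (c * 2) := fun c =>
    hasSum_geometric_two.mul_left c
  have hsum : ∀ z ∈ lineStrip 1, Summable fun i => a i z := fun z hz =>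
    Summable.of_norm_bounded (hgeo δ).summable fun i => (ha i z hz).trans (hle i)
  have hpartial : ∀ m z, u m (z + α) - u m z = ∑ i ∈ Finset.range m, a i z := by
    intro m z
    induction m with
    | zero => simp [u, st]
    | succ m ih =>
      rw [Finset.sum_range_succ, ← ih, hu]
      simp only [Pi.add_apply, a]; ring
  have htail : ∀ m, ∀ z ∈ lineStrip 1, ‖∑' i, a i z - (u m (z + α) - u m z)‖ ≤
      δ * (1 / 2) ^ m / (N m + 1) * 2 := by
    intro m z hz
    rw [hpartial, ← (hsum z hz).sum_add_tsum_nat_add m, add_sub_cancel_left]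
    refine tsum_of_norm_bounded (hgeo _) fun i => (ha (i + m) z hz).trans ?_
    have hN : (N m : ℝ) ≤ N (i + m) := by exact_mod_cast hNmono (by omega)
    calc δ * (1 / 2) ^ (i + m) / ((N (i + m) : ℝ) + 1) ≤ δ * (1 / 2) ^ (i + m) / (N m + 1) := by
          gcongr
      _ = _ := by rw [pow_add]; ring
  refine ⟨fun z => ∑' i, a i z, g, u, N,
    { circleHolo := ⟨?_, fun x => ?_, fun x => ?_⟩
      entire_g := fun i => (G (st i).1 (E i (N i))).2
      entire_u := fun i => (st i).1.2
      nonneg := fun i => h1 (st i).1 (E i (N i))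
      lintegral_le := fun i =>
        (h2 (st i).1 (E i (N i))).trans (ENNReal.ofReal_le_ofReal (hle i))
      hasSum := fun z hz => (hsum z hz).hasSum
      norm_le := fun z hz => ?_
      denseOrbits := fun i => ?_
      approx := fun i z hz => ?_ }⟩
  · refine Complex.differentiableOn_tsum_of_summable_norm (hgeo δ).summable (fun i => ?_)
      (isOpen_lineStrip 1) fun i z hz => (ha i z hz).trans (hle i)
    exact ((G (st i).1 (E i (N i))).2.coboundary α).entire.differentiableOn
  · exact tsum_congr fun i => ((G (st i).1 (E i (N i))).2.coboundary α).periodic x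
  · rw [Complex.im_tsum (hsum x (ofReal_mem_lineStrip one_pos x))]
    simp only [((G (st _).1 (E _ (N _))).2.coboundary α).real, a, g, tsum_zero]
  · refine (tsum_of_norm_bounded (hgeo δ) fun i => (ha i z hz).trans (hle i)).trans_eq ?_
    ring
  · exact (h4 (st i).1 (E i (N i))).mono (by rw [hNs]; omega) (hle i)
  · rw [norm_sub_rev]
    refine (htail (i + 1) z hz).trans_eq ?_
    rw [pow_succ]; ring

/-! ### Minimality of the limit -/

lemma iterate_skewHomeo {φ : ℂ → ℂ} (h : CircleHolo φ) (α x y : ℝ) (n : ℕ) :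
    (skewHomeo α h.circleMap)^[n] (torusProj (x, y)) =
      torusProj (x + n * α, y + ∑ k ∈ Finset.range n, (φ ((x + k * α : ℝ) : ℂ)).re) := by
  induction n with
  | zero => simp
  | succ n ih =>
    rw [Function.iterate_succ_apply', ih, skewHomeo_torusProj, Finset.sum_range_succ]
    simp only [skewLift]
    congr 2
    · push_cast; ring
    · ring

lemma dist_torusProj_lt {p q : ℝ × ℝ} {ε : ℝ} (h1 : ∃ j : ℤ, |p.1 - q.1 - j| < ε)
    (h2 : ∃ k : ℤ, |p.2 - q.2 - k| < ε) : dist (torusProj p) (torusProj q) < ε := by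
  have key : ∀ x y : ℝ, (∃ j : ℤ, |x - y - j| < ε) →
      dist (x : UnitAddCircle) (y : UnitAddCircle) < ε := by
    rintro x y ⟨j, hj⟩
    rw [dist_eq_norm, ← AddCircle.coe_sub, AddCircle.norm_eq]
    simp only [inv_one, one_mul, mul_one]
    exact (round_le _ j).trans_lt hj
  exact max_lt (key _ _ h1) (key _ _ h2)

namespace LimitCocycle

variable {α δ : ℝ} {φ : ℂ → ℂ} {g u : ℕ → ℂ → ℂ} {N : ℕ → ℕ}

/-- Up to time N (i + 1) the Birkhoff sums of φ stay within δ / 2 ^ i of the telescoping sums for u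
(i + 1), whose orbits are dense at that same scale. The two errors account for the ε / 2 below. -/
lemma isMinimalMap (h : LimitCocycle α δ φ g u N) :
    IsMinimalMap (skewHomeo α h.circleHolo.circleMap) := by
  intro p
  obtain ⟨⟨x, y⟩, rfl⟩ := torusProj_surjective p
  rw [Metric.dense_iff]
  intro p' ε hε
  obtain ⟨⟨x', y'⟩, rfl⟩ := torusProj_surjective p'
  obtain ⟨i, hi⟩ : ∃ i : ℕ, δ * (1 / 2) ^ i < ε / 2 := by
    have := (tendsto_pow_atTop_nhds_zero_of_lt_one (r := (1 / 2 : ℝ)) (by norm_num)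
      (by norm_num)).const_mul δ
    rw [mul_zero] at this
    exact (this.eventually (gt_mem_nhds (half_pos hε))).exists
  obtain ⟨n, hn, j, k, hj, hk⟩ := h.denseOrbits i x y x' y'
  refine ⟨_, ?_, ⟨n, rfl⟩⟩
  simp only [Metric.mem_ball, iterate_skewHomeo]
  set v := u (i + 1) with hv
  have hN : (n : ℝ) ≤ N (i + 1) := by exact_mod_cast hn
  have hpos : 0 ≤ δ * (1 / 2) ^ i := by
    by_contra hneg
    linarith [abs_nonneg (x + n * α - x' - j)]
  have htel : (v ((x + n * α : ℝ) : ℂ)).re - (v x).re =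
      ∑ k ∈ Finset.range n,
        ((v ((x + (k + 1 : ℕ) * α : ℝ) : ℂ)).re - (v ((x + k * α : ℝ) : ℂ)).re) := by
    rw [Finset.sum_range_sub (fun k : ℕ => (v ((x + k * α : ℝ) : ℂ)).re)]
    simp
  have hterm : ∀ k : ℕ, |((v ((x + (k + 1 : ℕ) * α : ℝ) : ℂ)).re - (v ((x + k * α : ℝ) : ℂ)).re) -
      (φ ((x + k * α : ℝ) : ℂ)).re| ≤ δ * (1 / 2) ^ i / (N (i + 1) + 1) := by
    intro k
    have := h.approx i _ (ofReal_mem_lineStrip one_pos (x + k * α))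
    have e : ((x + (k + 1 : ℕ) * α : ℝ) : ℂ) = ((x + k * α : ℝ) : ℂ) + α := by push_cast; ring
    rw [e]
    simpa using (Complex.abs_re_le_norm _).trans this
  have hS : |((v ((x + n * α : ℝ) : ℂ)).re - (v x).re) -
      ∑ k ∈ Finset.range n, (φ ((x + k * α : ℝ) : ℂ)).re| ≤ δ * (1 / 2) ^ i := by
    rw [htel, ← Finset.sum_sub_distrib]
    refine (Finset.abs_sum_le_sum_abs _ _).trans ((Finset.sum_le_sum fun k _ => hterm k).trans ?_)
    rw [Finset.sum_const, Finset.card_range, nsmul_eq_mul, mul_div_assoc', div_le_iff₀ (by positivity)]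
    nlinarith
  refine dist_torusProj_lt ⟨j, by simp only; linarith⟩ ⟨k, ?_⟩
  simp only
  rw [abs_lt] at hk ⊢
  rw [abs_le] at hS
  constructor <;> linarith [hk.1, hk.2, hS.1, hS.2]

end LimitCocycle

/-! ### Invariance of Lebesgue measure and failure of ergodicity -/

/-- Fubini: a rotation of the base and a rotation in each fibre. Mere measurability of c is what
allows the transfer function U as a shear. -/
lemma measurePreserving_fibreShift {c : UnitAddCircle → UnitAddCircle} (hc : Measurable c)
    (b : UnitAddCircle) :
    MeasurePreserving (fun p : Torus => (p.1 + b, p.2 + c p.1)) volume volume :=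
  MeasurePreserving.skew_product (measurePreserving_add_right volume b)
    (g := fun a y => y + c a) (by unfold Function.uncurry; fun_prop)
    (Filter.Eventually.of_forall fun a => (measurePreserving_add_right volume (c a)).map_eq)

lemma measurePreserving_skewHomeo (α : ℝ) (c : C(UnitAddCircle, ℝ)) :
    MeasurePreserving (skewHomeo α c) (volume : Measure Torus) volume :=
  measurePreserving_fibreShift (c := fun a => (c a : UnitAddCircle))
    ((AddCircle.measurable_mk' (a := (1 : ℝ))).comp (map_continuous c).measurable) α

/-- A skew product whose displacement is a measurable coboundary is not ergodic. -/
lemma not_ergodic_of_ae_coboundary {α : ℝ} {c : C(UnitAddCircle, ℝ)} {U : UnitAddCircle → ℝ}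
    (hU : Measurable U)
    (h : ∀ᵐ a : UnitAddCircle, U (a + (α : UnitAddCircle)) = U a + c a) :
    ¬ Ergodic (skewHomeo α c) (volume : Measure Torus) := by
  intro herg
  have hUm : Measurable fun a => (((-U a : ℝ)) : UnitAddCircle) :=
    (AddCircle.measurable_mk' (a := (1 : ℝ))).comp hU.neg
  let H : Torus → UnitAddCircle := fun p => p.2 + ((-U p.1 : ℝ) : UnitAddCircle)
  have : IsProbabilityMeasure (volume : Measure UnitAddCircle) := ⟨UnitAddCircle.measure_univ⟩
  -- H straightens the invariant graphs y = U(x) + const. Its distribution is Lebesgue measure,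
  -- without atoms, so H cannot be constant almost everywhere.
  have hH : MeasurePreserving H volume volume :=
    measurePreserving_snd.comp (measurePreserving_fibreShift hUm 0)
  have hinv : H ∘ skewHomeo α c =ᵐ[volume] H := by
    have h' : ∀ᵐ p : Torus, U (p.1 + (α : UnitAddCircle)) = U p.1 + c p.1 :=
      Measure.quasiMeasurePreserving_fst.ae h
    filter_upwards [h'] with p hp
    simp only [H, Function.comp_apply, skewHomeo_apply, hp, neg_add, AddCircle.coe_add,
      AddCircle.coe_neg]
    abel
  obtain ⟨b, hb⟩ := herg.ae_eq_const_of_ae_eq_comp_ae hH.measurable.aestronglyMeasurable hinv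
  have h0 : volume (H ⁻¹' {b}) = 0 := by
    rw [hH.measure_preimage (measurableSet_singleton b).nullMeasurableSet,
      volume_singleton_circle]
  have h1 : ∀ᵐ _ : Torus, False := by
    have h2 : ∀ᵐ p : Torus, p ∉ H ⁻¹' {b} := measure_eq_zero_iff_ae_notMem.1 h0
    filter_upwards [hb, h2] with p hp hp' using hp' hp
  exact h1.exists.elim fun _ hf => hf

lemma hasSum_toReal_tsum_ofReal {f : ℕ → ℝ} (h0 : ∀ i, 0 ≤ f i)
    (h : ∑' i, ENNReal.ofReal (f i) < ⊤) : HasSum f (∑' i, ENNReal.ofReal (f i)).toReal := by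
  have hs : Summable f :=
    (ENNReal.summable_toReal h.ne).congr fun i => ENNReal.toReal_ofReal (h0 i)
  rw [← ENNReal.ofReal_tsum_of_nonneg h0 hs, ENNReal.toReal_ofReal (tsum_nonneg h0)]
  exact hs.hasSum

/-- A skew product whose displacement is the sum of the coboundaries of nonnegative functions with
summable integrals is not ergodic. -/
lemma not_ergodic_of_hasSum {α : ℝ} {c : C(UnitAddCircle, ℝ)} {G : ℕ → C(UnitAddCircle, ℝ)}
    (hG0 : ∀ i a, 0 ≤ G i a) (hGi : ∑' i, ∫⁻ a, ENNReal.ofReal (G i a) ≠ ⊤)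
    (hsum : ∀ a, HasSum (fun i => G i (a + (α : UnitAddCircle)) - G i a) (c a)) :
    ¬ Ergodic (skewHomeo α c) (volume : Measure Torus) := by
  have hGm : ∀ i, Measurable fun a => ENNReal.ofReal (G i a) := fun i =>
    ENNReal.measurable_ofReal.comp (map_continuous (G i)).measurable
  have hV : Measurable fun a => ∑' i, ENNReal.ofReal (G i a) := Measurable.tsum hGm
  -- Tonelli: nonnegativity and summable integrals give finiteness almost everywhere. Finiteness at
  -- both a and a + α then permits termwise subtraction.
  have hfin : ∀ᵐ a, ∑' i, ENNReal.ofReal (G i a) < ⊤ := by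
    refine ae_lt_top hV ?_
    rwa [lintegral_tsum fun i => (hGm i).aemeasurable]
  have hR : Measure.QuasiMeasurePreserving (fun a : UnitAddCircle => a + (α : UnitAddCircle)) :=
    (measurePreserving_add_right volume (α : UnitAddCircle)).quasiMeasurePreserving
  have hfin' : ∀ᵐ a : UnitAddCircle, ∑' i, ENNReal.ofReal (G i (a + (α : UnitAddCircle))) < ⊤ :=
    hR.ae (p := fun a => ∑' i, ENNReal.ofReal (G i a) < ⊤) hfin
  refine not_ergodic_of_ae_coboundary
    (U := fun a => (∑' i, ENNReal.ofReal (G i a)).toReal) hV.ennreal_toReal ?_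
  filter_upwards [hfin, hfin'] with a ha ha'
  have s := (hasSum_toReal_tsum_ofReal (fun i => hG0 i _) ha').sub
    (hasSum_toReal_tsum_ofReal (fun i => hG0 i a) ha)
  linarith [s.unique (hsum a)]

lemma LimitCocycle.not_ergodic {α δ : ℝ} {φ : ℂ → ℂ} {g u : ℕ → ℂ → ℂ} {N : ℕ → ℕ}
    (h : LimitCocycle α δ φ g u N) :
    ¬ Ergodic (skewHomeo α h.circleHolo.circleMap) (volume : Measure Torus) := by
  refine not_ergodic_of_hasSum (G := fun i => (h.entire_g i).circleHolo.circleMap)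
    (fun i a => ?_) ?_ fun a => ?_
  · obtain ⟨x, rfl⟩ := QuotientAddGroup.mk_surjective a
    exact (h.nonneg i x).trans_eq (CircleHolo.circleMap_coe _ x).symm
  · refine ne_top_of_le_ne_top ?_ (ENNReal.tsum_le_tsum h.lintegral_le)
    exact (summable_geometric_two.mul_left δ).tsum_ofReal_ne_top
  · obtain ⟨x, rfl⟩ := QuotientAddGroup.mk_surjective a
    have hs := Complex.hasSum_re (h.hasSum x (ofReal_mem_lineStrip one_pos x))
    refine HasSum.congr_fun hs fun i => ?_
    have e : (h.entire_g i).circleHolo.circleMap ((x + α : ℝ) : UnitAddCircle) =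
        (g i ((x + α : ℝ) : ℂ)).re := CircleHolo.circleMap_coe _ _
    rw [Complex.sub_re, ← Complex.ofReal_add, ← e, AddCircle.coe_add]
    rfl

/-! ### Conclusion -/

/-- The conjugacy to R_α is S⁻¹ ∘ T, where S is the area-preserving shear by v. -/
lemma conjSkew_coboundary_mem {T : Torus ≃ₜ Torus} (hT : IsAnalyticDiffeo T)
    (hTm : MeasurePreserving T (volume : Measure Torus) volume) (α : ℝ) {v : ℂ → ℂ}
    (hv : EntirePeriodic v) :
    conjSkew hT α (hv.coboundary α).circleHolo ∈ conjRotation α := by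
  let S := skewHomeo 0 hv.circleHolo.circleMap
  have hS : MeasurePreserving S.symm (volume : Measure Torus) volume :=
    MeasurePreserving.symm S.toMeasurableEquiv (measurePreserving_skewHomeo _ _)
  refine ⟨T.trans S.symm, hT.trans (isAnalyticDiffeo_skewHomeo hv.circleHolo 0).symm,
    hS.comp hTm, fun p => ?_⟩
  rw [conjSkew_apply]
  show T.symm _ = T.symm (S (torusRotation α (S.symm (T p))))
  congr 1
  obtain ⟨q, hq⟩ := S.surjective (T p)
  rw [← hq, Homeomorph.symm_apply_apply]
  obtain ⟨⟨x, y⟩, rfl⟩ := torusProj_surjective q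
  have e : torusRotation α (torusProj (x, y)) = torusProj (x + α, y) := rfl
  rw [e, skewHomeo_torusProj, skewHomeo_torusProj, skewHomeo_torusProj]
  simp [skewLift]

lemma isMinimalMap_conj {T S : Torus ≃ₜ Torus} (h : IsMinimalMap S) :
    IsMinimalMap (T.trans (S.trans T.symm)) := by
  intro p
  have e : ∀ n : ℕ, (T.trans (S.trans T.symm))^[n] p = T.symm (S^[n] (T p)) := by
    intro n
    have hs : Function.Semiconj T.symm S (T.trans (S.trans T.symm)) := fun q => by simp
    rw [(hs.iterate_right n).eq, Homeomorph.symm_apply_apply]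
  simp only [e]
  exact T.symm.surjective.denseRange.comp (h (T p)) T.symm.continuous

theorem theoremB :
    ∃ s : Set ℝ, IsGδ s ∧ Dense s ∧ ∀ α ∈ s,
      ∃ D : Set DiffTorus, D ⊆ closure (conjRotation α) ∧ closure (conjRotation α) ⊆ closure D ∧
        ∀ G ∈ D, IsMinimalMap G.1 ∧
          MeasurePreserving G.1 (volume : Measure Torus) (volume : Measure Torus) ∧
          ¬ Ergodic G.1 (volume : Measure Torus) := by
  refine ⟨goodAngles, isGδ_goodAngles, dense_goodAngles, fun α hα => ?_⟩
  -- With D taken as large as possible, density need only be checked at points of `conjRotation α`.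
  refine ⟨{G | G ∈ closure (conjRotation α) ∧ IsMinimalMap G.1 ∧
    MeasurePreserving G.1 (volume : Measure Torus) (volume : Measure Torus) ∧
    ¬ Ergodic G.1 (volume : Measure Torus)}, fun G hG => hG.1,
    closure_minimal ?_ isClosed_closure, fun G hG => hG.2⟩
  rintro F ⟨T, hT, hTm, hF⟩
  have hFe : F = conjSkew hT α EntirePeriodic.zero.circleHolo := by
    refine Subtype.ext (Homeomorph.ext fun p => ?_)
    rw [hF, conjSkew_apply]
    obtain ⟨⟨x, y⟩, hq⟩ := torusProj_surjective (T p)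
    rw [← hq, skewHomeo_torusProj]
    simp [torusRotation, torusProj, skewLift]
  rw [mem_closure_iff]
  intro O hO hFO
  rw [hFe] at hFO
  obtain ⟨η, hη, hηO⟩ := exists_forall_conjSkew_mem hT EntirePeriodic.zero.circleHolo
    (fun z _ => by simp) α hO hFO
  -- As ‖φ‖ ≤ 2δ, the bound η / 2 puts the map in O, and 1 / 2 gives ‖φ‖ ≤ 1, needed to apply
  -- continuity again, now at φ.
  obtain ⟨φ, g, u, N, h⟩ := exists_limitCocycle hα (δ := min (1 / 2) (η / 2))
    (lt_min (by norm_num) (by positivity))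
  have hφ1 : ∀ z ∈ lineStrip 1, ‖φ z‖ ≤ 1 := fun z hz =>
    (h.norm_le z hz).trans (by linarith [min_le_left (1 / 2) (η / 2)])
  refine ⟨conjSkew hT α h.circleHolo, hηO φ h.circleHolo fun z hz => ?_, ?_,
    isMinimalMap_conj h.isMinimalMap, ?_, fun herg => h.not_ergodic ?_⟩
  · simpa using (h.norm_le z hz).trans (by linarith [min_le_right (1 / 2) (η / 2)])
  · rw [mem_closure_iff]
    intro O' hO' hmem
    obtain ⟨η', hη', hηO'⟩ := exists_forall_conjSkew_mem hT h.circleHolo hφ1 α hO' hmem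
    obtain ⟨i, hi⟩ : ∃ i : ℕ, min (1 / 2) (η / 2) * (1 / 2) ^ i < η' := by
      have := (tendsto_pow_atTop_nhds_zero_of_lt_one (r := (1 / 2 : ℝ)) (by norm_num)
        (by norm_num)).const_mul (min (1 / 2) (η / 2))
      rw [mul_zero] at this
      exact (this.eventually (gt_mem_nhds hη')).exists
    -- Coboundaries of the partial sums converge to φ uniformly on the unit strip, so their
    -- conjugates enter every neighbourhood of the limit map.
    refine ⟨_, hηO' _ ((h.entire_u (i + 1)).coboundary α).circleHolo fun z hz => ?_,
      conjSkew_coboundary_mem hT hTm α (h.entire_u (i + 1))⟩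
    refine (h.approx i z hz).trans (le_trans (div_le_self (by positivity) ?_) hi.le)
    linarith [Nat.cast_nonneg (α := ℝ) (N (i + 1))]
  · exact (MeasurePreserving.symm T.toMeasurableEquiv hTm).comp
      ((measurePreserving_skewHomeo α h.circleHolo.circleMap).comp hTm)
  · have hTs : MeasurePreserving T.symm.toMeasurableEquiv (volume : Measure Torus) volume :=
      MeasurePreserving.symm T.toMeasurableEquiv hTm
    exact (hTs.ergodic_conjugate_iff (f := skewHomeo α h.circleHolo.circleMap)).1 herg
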